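/- **Setting.** Let $n\ge 0$. A *$q$-graded Temperley–Lieb diagram* $q^iA$ consists of an isotopy class of a planar diagram $A$ without crossings in a strip, with $n$ end points on the top edge and $n$ on the bottom edge (closed circles allowed), and an integer $i$. Let $\mathrm{Cob}(n)$ be the following category (Bar-Natan's dotted cobordism category). Its objects are the $q$-graded Temperley–Lieb diagrams. A morphism $q^iA\to q^jB$ is a $\mathbb Z$-linear combination of isotopy classes of orientable cobordisms from $A$ to $B$ embedded in (strip)$\times[0,1]$, fixed near the end points, and decorated with finitely many dots that move freely on components. Only cobordisms $C$ of degree $0$ are used, where $|C|=\chi(C)-n+j-i$ and each dot contributes $-2$ (a dot is "half a handle"). These combinations are taken modulo the following local relations. * A sphere without dots is $0$, a sphere with one dot is $1$, and a sphere with two dots is $0$. * A sphere with three dots is a free parameter $\alpha$ of degree $-4$, which is absorbed into the base ring. * (Neck cutting) A cylinder equals the sum of the two surfaces obtained by cutting it, capping both ends with discs, and putting a dot on one of the two discs. Let $\mathrm{Kom}(n)$ be the category of cochain complexes, in homological degrees $\ge 0$, of finite formal direct sums of objects of $\mathrm{Cob}(n)$, and let $\simeq$ denote chain homotopy equivalence.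 For $C,D\in\mathrm{Kom}(n)$, let $C\otimes D$ be the complex obtained by gluing all diagrams and cobordisms, those of $C$ on top of those of $D$. That is, $C\otimes D$ is the total complex of the double complex $C_i\otimes D_j$, with differential $d\otimes 1+(-1)^i\,1\otimes d$, and with $q^iA\otimes q^jB=q^{i+j}AB$. Let $1\in\mathrm{Cob}(2)$ be the identity diagram (two vertical strands), and let $e_1$ be the turnback diagram, in which the two upper end points are joined by an arc and so are the two lower ones. Regard $e_1$ also as a complex concentrated in homological degree $0$ with $q$-degree $0$. Define $P_2=(C_*,d_*)\in\mathrm{Kom}(2)$ by $$C_0=q^0\,1,\qquad C_m=q^{2m-1}e_1\quad(m>0),$$ where $d_0:1\to q\,e_1$ is the saddle cobordism and, for $m>0$, $d_m:q^{2m-1}e_1\to q^{2m+1}e_1$ is $$d_m=\begin{cases}\text{top dot}+\text{bottom dot}, & m\text{ even},\\ \text{top dot}-\text{bottom dot}, & m\text{ odd}.\end{cases}$$ Here "top dot" (resp. "bottom dot") is the identity cobordism of $e_1$ with one dot on the sheet over its upper (resp. lower) arc. One has $d_{m+1}d_m=0$. **Theorem.** The complex $P_2$ is contractible under turnback and is a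 homotopy idempotent: $$P_2\otimes e_1\simeq 0\simeq e_1\otimes P_2\qquad\text{and}\qquad P_2\otimes P_2\simeq P_2 .$$ -/

import Mathlib

open CategoryTheory

namespace BarNatan

/-- Elementary pieces of a planar diagram in a strip, read from top to bottom. `cup i` joins the strands
in positions `i` and `i + 1` entering from above, so that they turn back; `cap i` creates two new
strands in positions `i` and `i + 1` leaving below. Positions are counted from `0`, from the left. -/
inductive Letter : Type
  | cup (i : ℕ)
  | cap (i : ℕ)

namespace Letter

/-- The number of strands below a letter, if there are `k` strands above it and it fits. -/
def width : Letter → ℕ → Option ℕ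
  | cup i, k => if i + 2 ≤ k then some (k - 2) else none
  | cap i, k => if i ≤ k then some (k + 2) else none

/-- The arcs of a letter: `Strand a (s, i) (t, j)` says that an arc of `a` joins position `i` on its upper
(`s = 0`) or lower (`s = 1`) edge with position `j` on its upper (`t = 0`) or lower (`t = 1`) edge. -/
inductive Strand : Letter → ℕ × ℕ → ℕ × ℕ → Prop
  | cup_turn (i : ℕ) : Strand (cup i) (0, i) (0, i + 1)
  | cup_left (i j : ℕ) (h : j < i) : Strand (cup i) (0, j) (1, j)
  | cup_right (i j : ℕ) (h : i ≤ j) : Strand (cup i) (0, j + 2) (1, j)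
  | cap_turn (i : ℕ) : Strand (cap i) (1, i) (1, i + 1)
  | cap_left (i j : ℕ) (h : j < i) : Strand (cap i) (0, j) (1, j)
  | cap_right (i j : ℕ) (h : i ≤ j) : Strand (cap i) (0, j) (1, j + 2)

end Letter

/-- The number of strands below a word of letters, with `k` strands above it. -/
def endWidth : List Letter → ℕ → Option ℕ
  | [], k => some k
  | a :: w, k => (a.width k).bind (endWidth w)

theorem endWidth_append (u v : List Letter) (k : ℕ) :
    endWidth (u ++ v) k = (endWidth u k).bind (endWidth v) := by
  induction u generalizing k with
  | nil => rfl
  | cons a u ih =>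
    simp only [List.cons_append, endWidth]
    cases a.width k with
    | none => rfl
    | some l => simp [ih]

/-- The number of strands at level `t` of a word, i.e. below its first `t` letters. -/
def strands (n : ℕ) (w : List Letter) (t : ℕ) : ℕ := (endWidth (w.take t) n).getD 0

/-- A `q`-graded Temperley-Lieb diagram `q ^ deg · word` with `n` end points on the top and `n` on the
bottom of a strip; closed circles are allowed. Every such diagram is, up to planar isotopy, a stack of
letters, and isotopic diagrams become isomorphic objects below. -/
structure Diagram (n : ℕ) : Type where
  word : List Letter
  valid : endWidth word n = some n
  deg : ℤ

namespace Diagram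

variable {n : ℕ}

/-- The points where a diagram meets the levels between its letters: `(t, j)` is the point in
position `j` on level `t`. -/
def Vertex (X : Diagram n) : Type :=
  {x : ℕ × ℕ // x.1 ≤ X.word.length ∧ x.2 < strands n X.word x.1}

/-- Two such points are joined by an arc of one letter. -/
def Joined (X : Diagram n) (x y : X.Vertex) : Prop :=
  ∃ (t : ℕ) (a : Letter) (p q : ℕ × ℕ), X.word[t]? = some a ∧ a.Strand p q ∧
    x.1 = (t + p.1, p.2) ∧ y.1 = (t + q.1, q.2)

/-- Gluing: the diagram `X` is stacked on top of `Y`, and `q`-degrees add. -/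
def glue (X Y : Diagram n) : Diagram n where
  word := X.word ++ Y.word
  valid := by simp [endWidth_append, X.valid, Y.valid]
  deg := X.deg + Y.deg

end Diagram

/-- The elementary planar isotopies: cancellation of a maximum with a minimum, and exchange of the heights
of two distant letters. -/
inductive PlanarIsotopy : List Letter → List Letter → Prop
  | zigzag_right (i : ℕ) : PlanarIsotopy [.cap i, .cup (i + 1)] []
  | zigzag_left (i : ℕ) : PlanarIsotopy [.cap (i + 1), .cup i] []
  | cap_cap (i j : ℕ) (h : i ≤ j) : PlanarIsotopy [.cap i, .cap (j + 2)] [.cap j, .cap i]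
  | cup_cup (i j : ℕ) (h : i ≤ j) : PlanarIsotopy [.cup (j + 2), .cup i] [.cup i, .cup j]
  | cap_cup (i j : ℕ) (h : i ≤ j) : PlanarIsotopy [.cap i, .cup (j + 2)] [.cup j, .cap i]
  | cup_cap (i j : ℕ) (h : i ≤ j) : PlanarIsotopy [.cap (j + 2), .cup i] [.cup i, .cap j]
  | symm {u v : List Letter} (h : PlanarIsotopy u v) : PlanarIsotopy v u

/-- Elementary cobordisms, each changing one spot of a diagram: the trace of an elementary isotopy, the
birth or death of a small circle, a saddle (in either direction) and a dot put on strand `j`. -/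
inductive LocalMove : Type
  | isotopy (u v : List Letter) (h : PlanarIsotopy u v)
  | birth (i : ℕ)
  | death (i : ℕ)
  | saddle (i : ℕ)
  | cosaddle (i : ℕ)
  | dot (j : ℕ)

namespace LocalMove

/-- The word at the spot before the move. -/
def source : LocalMove → List Letter
  | isotopy u _ _ => u
  | birth _ => []
  | death i => [.cap i, .cup i]
  | saddle _ => []
  | cosaddle i => [.cup i, .cap i]
  | dot _ => []

/-- The word at the spot after the move. -/
def target : LocalMove → List Letter
  | isotopy _ v _ => v
  | birth i => [.cap i, .cup i]
  | death _ => []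
  | saddle i => [.cup i, .cap i]
  | cosaddle _ => []
  | dot _ => []

/-- The change of the Euler characteristic of the surface made by the move. -/
def euler : LocalMove → ℤ
  | birth _ | death _ => 1
  | saddle _ | cosaddle _ => -1
  | isotopy _ _ _ | dot _ => 0

/-- The number of dots put on the surface by the move. -/
def dots : LocalMove → ℕ
  | dot _ => 1
  | _ => 0

/-- A cobordism `C : q ^ i A → q ^ j B` between diagrams with `2 n` end points has degree
`χ(C) - n + j - i`. As the product of a diagram with an interval has `χ - n = 0`, the elementary pieces
contribute their `euler`; a dot stands for half a handle and so contributes `-2`. -/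
def degree (m : LocalMove) : ℤ := m.euler - 2 * m.dots

end LocalMove

/-- An elementary cobordism of degree zero from `X` to `Y`: a local move made below the letters `pre` and
above the letters `post`. The level at `pre` has to carry the strand on which a dot is put. -/
structure Move {n : ℕ} (X Y : Diagram n) : Type where
  pre : List Letter
  post : List Letter
  loc : LocalMove
  source_eq : X.word = pre ++ loc.source ++ post
  target_eq : Y.word = pre ++ loc.target ++ post
  dot_mem : ∀ j, loc = .dot j → ∃ k, endWidth pre n = some k ∧ j < k
  deg_eq : loc.degree + Y.deg - X.deg = 0

namespace Move

variable {n : ℕ}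

/-- The points of `X` away from the spot of the move are carried along to points of `Y`. -/
def Tracks {X Y : Diagram n} (m : Move X Y) (x : X.Vertex) (y : Y.Vertex) : Prop :=
  (x.1.1 ≤ m.pre.length ∧ y.1 = x.1) ∨
  (m.pre.length + m.loc.source.length ≤ x.1.1 ∧ y.1.2 = x.1.2 ∧
    y.1.1 + m.loc.source.length = x.1.1 + m.loc.target.length)

/-- A point, of the diagram before or of the one after the move, that lies on the component of the
surface on which the birth, death, saddle or dot takes place. -/
def IsSite {X Y : Diagram n} (m : Move X Y) (s : X.Vertex ⊕ Y.Vertex) : Prop :=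
  match m.loc with
  | .isotopy _ _ _ => False
  | .birth i => ∃ y : Y.Vertex, s = .inr y ∧ y.1 = (m.pre.length + 1, i)
  | .death i => ∃ x : X.Vertex, s = .inl x ∧ x.1 = (m.pre.length + 1, i)
  | .saddle i | .cosaddle i | .dot i => ∃ x : X.Vertex, s = .inl x ∧ x.1 = (m.pre.length, i)

/-- The move `m` is the local move `loc` made below the letters `pre`. -/
def At {X Y : Diagram n} (m : Move X Y) (pre : List Letter) (loc : LocalMove) : Prop :=
  m.pre = pre ∧ m.loc = loc

def glueLeft (D : Diagram n) {X Y : Diagram n} (m : Move X Y) : Move (D.glue X) (D.glue Y) where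
  pre := D.word ++ m.pre
  post := m.post
  loc := m.loc
  source_eq := by simp [Diagram.glue, m.source_eq]
  target_eq := by simp [Diagram.glue, m.target_eq]
  dot_mem := by simpa [endWidth_append, D.valid] using m.dot_mem
  deg_eq := by have := m.deg_eq; simp only [Diagram.glue]; linarith

def glueRight {X Y : Diagram n} (m : Move X Y) (D : Diagram n) : Move (X.glue D) (Y.glue D) where
  pre := m.pre
  post := m.post ++ D.word
  loc := m.loc
  source_eq := by simp [Diagram.glue, m.source_eq]
  target_eq := by simp [Diagram.glue, m.target_eq]
  dot_mem := m.dot_mem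
  deg_eq := by have := m.deg_eq; simp only [Diagram.glue]; linarith

end Move

/-- A cobordism from `X` to `Y`, given by a movie: a finite sequence of elementary cobordisms. It is the
dotted surface with boundary traced out by the frames. -/
inductive Movie {n : ℕ} (X : Diagram n) : Diagram n → Type
  | nil : Movie X X
  | snoc {Y Z : Diagram n} (p : Movie X Y) (m : Move Y Z) : Movie X Z

namespace Movie

variable {n : ℕ}

/-- Composition of cobordisms: one movie after the other. -/
def comp {X Y : Diagram n} (p : Movie X Y) : {Z : Diagram n} → Movie Y Z → Movie X Z
  | _, .nil => p
  | _, .snoc q m => (p.comp q).snoc m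

theorem nil_comp {X Y : Diagram n} (p : Movie X Y) : nil.comp p = p := by
  induction p with
  | nil => rfl
  | snoc p m ih => rw [comp, ih]

theorem comp_assoc {X Y Z W : Diagram n} (p : Movie X Y) (q : Movie Y Z) (r : Movie Z W) :
    (p.comp q).comp r = p.comp (q.comp r) := by
  induction r with
  | nil => rfl
  | snoc r m ih => rw [comp, comp, comp, ih]

def glueLeft (D : Diagram n) {X : Diagram n} :
    {Y : Diagram n} → Movie X Y → Movie (D.glue X) (D.glue Y)
  | _, .nil => .nil
  | _, .snoc p m => (glueLeft D p).snoc (m.glueLeft D)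

def glueRight {X : Diagram n} :
    {Y : Diagram n} → Movie X Y → (D : Diagram n) → Movie (X.glue D) (Y.glue D)
  | _, .nil, _ => .nil
  | _, .snoc p m, D => (glueRight p D).snoc (m.glueRight D)

theorem glueLeft_comp (D : Diagram n) {X Y Z : Diagram n} (p : Movie X Y) (q : Movie Y Z) :
    glueLeft D (p.comp q) = (glueLeft D p).comp (glueLeft D q) := by
  induction q with
  | nil => rfl
  | snoc q m ih => simp only [comp, glueLeft, ih]

theorem glueRight_comp (D : Diagram n) {X Y Z : Diagram n} (p : Movie X Y) (q : Movie Y Z) :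
    glueRight (p.comp q) D = (glueRight p D).comp (glueRight q D) := by
  induction q with
  | nil => rfl
  | snoc q m ih => simp only [comp, glueRight, ih]

/-- All points on all frames of a movie. -/
def Node {X : Diagram n} : {Y : Diagram n} → Movie X Y → Type
  | _, .nil => X.Vertex
  | Y, .snoc p _ => Node p ⊕ Y.Vertex

/-- The points on the first frame. -/
def first {X : Diagram n} : {Y : Diagram n} → (p : Movie X Y) → X.Vertex → Node p
  | _, .nil, x => x
  | _, .snoc p _, x => Sum.inl (first p x)

/-- The points on the last frame. -/
def last {X : Diagram n} : {Y : Diagram n} → (p : Movie X Y) → Y.Vertex → Node p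
  | _, .nil, y => y
  | _, .snoc _ _, y => Sum.inr y

/-- Two points are adjacent if an arc of one frame joins them or if one is carried along to the other
on the next frame. -/
def Adjacent {X : Diagram n} : {Y : Diagram n} → (p : Movie X Y) → Node p → Node p → Prop
  | _, .nil, x, y => X.Joined x y
  | Y, .snoc p m, a, b => match a, b with
    | .inl a, .inl b => Adjacent p a b
    | .inl a, .inr y => ∃ v, a = last p v ∧ Move.Tracks m v y
    | .inr y, .inr y' => Y.Joined y y'
    | .inr _, .inl _ => False

/-- The connected components of the surface traced out by a movie. -/
def Component {X Y : Diagram n} (p : Movie X Y) : Type := Quot (Adjacent p)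

/-- The component of a point. -/
def toComponent {X Y : Diagram n} (p : Movie X Y) (a : Node p) : Component p := Quot.mk _ a

open Classical in
/-- The sum of the weights `wt` of those moves of a movie that take place on the part of the surface
labelled `k`; used with the labelling of points by their components. -/
noncomputable def weight (wt : LocalMove → ℤ) {K : Type} (k : K) {X : Diagram n} :
    {Y : Diagram n} → (p : Movie X Y) → (Node p → K) → ℤ
  | _, .nil, _ => 0
  | _, .snoc p m, f => weight wt k p (fun a => f (Sum.inl a)) +
      if ∃ s, Move.IsSite m s ∧ f (Sum.map (last p) id s) = k then wt m.loc else 0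

/-- Two cobordisms between the same diagrams are the same dotted surface: there is a homeomorphism that
fixes the boundary and matches the numbers of dots on components. By the classification of compact
orientable surfaces with boundary this means that there is a bijection of components that respects the
boundary points at both ends, the Euler characteristic (for fixed boundary, the sum of the weights
`euler`) and the number of dots. Isotopic cobordisms are the same dotted surface, and conversely
different embeddings of a surface have the same class once neck cutting is imposed. -/
def SameSurface {X Y : Diagram n} (p q : Movie X Y) : Prop :=
  ∃ φ : Component p ≃ Component q,
    (∀ x, φ (toComponent p (first p x)) = toComponent q (first q x)) ∧
    (∀ y, φ (toComponent p (last p y)) = toComponent q (last q y)) ∧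
    (∀ c, weight LocalMove.euler c p (toComponent p) =
      weight LocalMove.euler (φ c) q (toComponent q)) ∧
    (∀ c, weight (fun m => m.dots) c p (toComponent p) =
      weight (fun m => m.dots) (φ c) q (toComponent q))

end Movie


/-- The free `ℤ`-module on the cobordisms from `X` to `Y`. -/
abbrev Formal {n : ℕ} (X Y : Diagram n) : Type := FreeAbelianGroup (Movie X Y)

namespace Formal

variable {n : ℕ}

/-- A cobordism as a formal combination. -/
def ofMovie {X Y : Diagram n} (p : Movie X Y) : Formal X Y := .of p

/-- The bilinear extension of composition. -/
def comp {X Y Z : Diagram n} : Formal X Y →+ Formal Y Z →+ Formal X Z :=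
  FreeAbelianGroup.lift fun p => FreeAbelianGroup.lift fun q => .of (p.comp q)

def glueLeft (D : Diagram n) {X Y : Diagram n} :
    Formal X Y →+ Formal (D.glue X) (D.glue Y) :=
  FreeAbelianGroup.map (Movie.glueLeft D)

def glueRight (D : Diagram n) {X Y : Diagram n} :
    Formal X Y →+ Formal (X.glue D) (Y.glue D) :=
  FreeAbelianGroup.map fun p => Movie.glueRight p D

@[simp]
theorem comp_of {X Y Z : Diagram n} (p : Movie X Y) (q : Movie Y Z) :
    comp (.of p) (.of q) = .of (p.comp q) := by
  simp [comp]

@[simp]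
theorem glueLeft_of (D : Diagram n) {X Y : Diagram n} (p : Movie X Y) :
    glueLeft D (.of p) = .of (Movie.glueLeft D p) := by
  simp [glueLeft]

@[simp]
theorem glueRight_of (D : Diagram n) {X Y : Diagram n} (p : Movie X Y) :
    glueRight D (.of p) = .of (Movie.glueRight p D) := by
  simp [glueRight]

theorem id_comp {X Y : Diagram n} (f : Formal X Y) : comp (ofMovie .nil) f = f := by
  induction f using FreeAbelianGroup.induction_on with
  | zero => simp
  | of p => simp [ofMovie, Movie.nil_comp]
  | neg p ih => simp [ih]
  | add f g hf hg => simp only [map_add, hf, hg]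

theorem comp_id {X Y : Diagram n} (f : Formal X Y) : comp f (ofMovie .nil) = f := by
  induction f using FreeAbelianGroup.induction_on with
  | zero => simp
  | of p => simp [ofMovie, Movie.comp]
  | neg p ih => simp only [map_neg, AddMonoidHom.neg_apply, ih]
  | add f g hf hg => simp only [map_add, AddMonoidHom.add_apply, hf, hg]

theorem comp_assoc {X Y Z W : Diagram n} (f : Formal X Y) (g : Formal Y Z) (h : Formal Z W) :
    comp (comp f g) h = comp f (comp g h) := by
  induction f using FreeAbelianGroup.induction_on with
  | zero => simp
  | neg p ih => simp only [map_neg, AddMonoidHom.neg_apply, ih]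
  | add f g hf hg => simp only [map_add, AddMonoidHom.add_apply, hf, hg]
  | of p =>
    induction g using FreeAbelianGroup.induction_on with
    | zero => simp
    | neg p ih => simp only [map_neg, AddMonoidHom.neg_apply, ih]
    | add f g hf hg => simp only [map_add, AddMonoidHom.add_apply, hf, hg]
    | of q =>
      induction h using FreeAbelianGroup.induction_on with
      | zero => simp
      | neg p ih => simp only [map_neg, ih]
      | add f g hf hg => simp only [map_add, hf, hg]
      | of r => simp [Movie.comp_assoc]

theorem glueLeft_comp (D : Diagram n) {X Y Z : Diagram n} (f : Formal X Y) (g : Formal Y Z) :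
    glueLeft D (comp f g) = comp (glueLeft D f) (glueLeft D g) := by
  induction f using FreeAbelianGroup.induction_on with
  | zero => simp
  | neg p ih => simp only [map_neg, AddMonoidHom.neg_apply, ih]
  | add f g hf hg => simp only [map_add, AddMonoidHom.add_apply, hf, hg]
  | of p =>
    induction g using FreeAbelianGroup.induction_on with
    | zero => simp
    | neg p ih => simp only [map_neg, ih]
    | add f g hf hg => simp only [map_add, hf, hg]
    | of q => simp [Movie.glueLeft_comp]

theorem glueRight_comp (D : Diagram n) {X Y Z : Diagram n} (f : Formal X Y) (g : Formal Y Z) :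
    glueRight D (comp f g) = comp (glueRight D f) (glueRight D g) := by
  induction f using FreeAbelianGroup.induction_on with
  | zero => simp
  | neg p ih => simp only [map_neg, AddMonoidHom.neg_apply, ih]
  | add f g hf hg => simp only [map_add, AddMonoidHom.add_apply, hf, hg]
  | of p =>
    induction g using FreeAbelianGroup.induction_on with
    | zero => simp
    | neg p ih => simp only [map_neg, ih]
    | add f g hf hg => simp only [map_add, hf, hg]
    | of q => simp [Movie.glueRight_comp]

end Formal

/-- The formal combinations that vanish in the quotient: the relations below, closed under linear
combinations, composition and gluing. A sphere without dots is `0`, one with one dot is `1`, one with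
two dots is `0`; no relation involves a sphere with three dots, which thus acts as the free variable `α`
of the base ring `ℤ[α]` (of degree `-4`, and central, since a closed surface can be moved anywhere).
`neck` is the neck cutting relation at a small circle `[cap i, cup i]`: the cylinder over the circle is
the sum of the two ways to cap it off and put a dot on one of the two discs. `exchange` says that moves
in the two parts of a glued diagram commute, which is an isotopy of the surface. -/
inductive Null {n : ℕ} : {X Y : Diagram n} → Formal X Y → Prop
  | surface {X Y : Diagram n} (p q : Movie X Y) (h : Movie.SameSurface p q) :
      Null (Formal.ofMovie p - Formal.ofMovie q)
  | sphere {X Y Z : Diagram n} (b : Move X Y) (d : Move Y Z) (pre : List Letter) (i : ℕ)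
      (hb : b.At pre (.birth i)) (hd : d.At pre (.death i)) :
      Null (Formal.ofMovie ((Movie.nil.snoc b).snoc d))
  | sphere_dot {X Y Z : Diagram n} (b : Move X Y) (t : Move Y Z) (d : Move Z X)
      (pre : List Letter) (i : ℕ) (hb : b.At pre (.birth i))
      (ht : t.At (pre ++ [.cap i]) (.dot i)) (hd : d.At pre (.death i)) :
      Null (Formal.ofMovie (((Movie.nil.snoc b).snoc t).snoc d) - Formal.ofMovie Movie.nil)
  | sphere_dot_dot {X Y Z W V : Diagram n} (b : Move X Y) (t : Move Y Z) (t' : Move Z W)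
      (d : Move W V) (pre : List Letter) (i : ℕ) (hb : b.At pre (.birth i))
      (ht : t.At (pre ++ [.cap i]) (.dot i)) (ht' : t'.At (pre ++ [.cap i]) (.dot i))
      (hd : d.At pre (.death i)) :
      Null (Formal.ofMovie ((((Movie.nil.snoc b).snoc t).snoc t').snoc d))
  | neck {X Y Z Y' Z' : Diagram n} (t : Move X Y) (d : Move Y Z) (b : Move Z X)
      (d' : Move X Y') (b' : Move Y' Z') (t' : Move Z' X) (pre : List Letter) (i : ℕ)
      (ht : t.At (pre ++ [.cap i]) (.dot i)) (hd : d.At pre (.death i)) (hb : b.At pre (.birth i))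
      (hd' : d'.At pre (.death i)) (hb' : b'.At pre (.birth i))
      (ht' : t'.At (pre ++ [.cap i]) (.dot i)) :
      Null (Formal.ofMovie Movie.nil - Formal.ofMovie (((Movie.nil.snoc t).snoc d).snoc b) -
        Formal.ofMovie (((Movie.nil.snoc d').snoc b').snoc t'))
  | exchange {X X' Y Y' : Diagram n} (m : Move X X') (k : Move Y Y') :
      Null (Formal.ofMovie ((Movie.nil.snoc (m.glueRight Y)).snoc (k.glueLeft X')) -
        Formal.ofMovie ((Movie.nil.snoc (k.glueLeft X)).snoc (m.glueRight Y')))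
  | zero {X Y : Diagram n} : Null (0 : Formal X Y)
  | add {X Y : Diagram n} {f g : Formal X Y} (hf : Null f) (hg : Null g) : Null (f + g)
  | neg {X Y : Diagram n} {f : Formal X Y} (hf : Null f) : Null (-f)
  | comp_left {X Y Z : Diagram n} (f : Formal X Y) {g : Formal Y Z} (hg : Null g) :
      Null (Formal.comp f g)
  | comp_right {X Y Z : Diagram n} {f : Formal X Y} (hf : Null f) (g : Formal Y Z) :
      Null (Formal.comp f g)
  | glueLeft (D : Diagram n) {X Y : Diagram n} {f : Formal X Y} (hf : Null f) :
      Null (Formal.glueLeft D f)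
  | glueRight (D : Diagram n) {X Y : Diagram n} {f : Formal X Y} (hf : Null f) :
      Null (Formal.glueRight D f)

/-- The subgroup of vanishing combinations. -/
def nullSubgroup {n : ℕ} (X Y : Diagram n) : AddSubgroup (Formal X Y) where
  carrier := {f | Null f}
  zero_mem' := Null.zero
  add_mem' := Null.add
  neg_mem' := Null.neg


namespace Diagram

variable {n : ℕ}

/-- Morphisms: combinations of cobordisms of degree zero modulo the relations. -/
def Hom (X Y : Diagram n) : Type := Formal X Y ⧸ nullSubgroup X Y

instance (X Y : Diagram n) : AddCommGroup (Hom X Y) :=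
  inferInstanceAs (AddCommGroup (Formal X Y ⧸ nullSubgroup X Y))

/-- The class of a formal combination. -/
def toHom {X Y : Diagram n} : Formal X Y →+ Hom X Y := QuotientAddGroup.mk' _

theorem toHom_eq_iff {X Y : Diagram n} {f g : Formal X Y} :
    toHom f = toHom g ↔ Null (f - g) := by
  rw [← sub_eq_zero, ← map_sub]
  exact QuotientAddGroup.eq_zero_iff _

theorem Hom.ind {X Y : Diagram n} {P : Hom X Y → Prop} (h : ∀ f, P (toHom f)) (f : Hom X Y) :
    P f :=
  QuotientAddGroup.induction_on f h

/-- Composition of classes. -/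
def Hom.comp {X Y Z : Diagram n} : Hom X Y → Hom Y Z → Hom X Z :=
  Quotient.map₂ (fun f g => Formal.comp f g) fun f f' hf g g' hg => by
    have hf : Null (-f + f') := QuotientAddGroup.leftRel_apply.mp hf
    have hg : Null (-g + g') := QuotientAddGroup.leftRel_apply.mp hg
    refine QuotientAddGroup.leftRel_apply.mpr ?_
    have := Null.add (Null.comp_right hf g) (Null.comp_left f' hg)
    change Null _
    convert this using 1
    simp only [map_add, map_neg, AddMonoidHom.add_apply, AddMonoidHom.neg_apply]
    abel

theorem Hom.comp_toHom {X Y Z : Diagram n} (f : Formal X Y) (g : Formal Y Z) :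
    Hom.comp (toHom f) (toHom g) = toHom (Formal.comp f g) := rfl

/-- The dotted cobordism category. -/
instance : Category.{0} (Diagram n) where
  Hom := Hom
  id X := toHom (Formal.ofMovie .nil)
  comp f g := Hom.comp f g
  id_comp f := by
    induction f using Hom.ind with
    | h f => rw [Hom.comp_toHom, Formal.id_comp]
  comp_id f := by
    induction f using Hom.ind with
    | h f => rw [Hom.comp_toHom, Formal.comp_id]
  assoc f g h := by
    induction f using Hom.ind with
    | h f =>
      induction g using Hom.ind with
      | h g =>
        induction h using Hom.ind with
        | h h => simp only [Hom.comp_toHom, Formal.comp_assoc]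

instance : Preadditive (Diagram n) where
  homGroup X Y := inferInstanceAs (AddCommGroup (Hom X Y))
  add_comp X Y Z f f' g := by
    induction f using Hom.ind with
    | h f =>
      induction f' using Hom.ind with
      | h f' =>
        induction g using Hom.ind with
        | h g =>
          change Hom.comp (toHom f + toHom f') (toHom g) =
            Hom.comp (toHom f) (toHom g) + Hom.comp (toHom f') (toHom g)
          simp only [← map_add, Hom.comp_toHom]
          rw [map_add, AddMonoidHom.add_apply]
  comp_add X Y Z f g g' := by
    induction f using Hom.ind with
    | h f =>
      induction g using Hom.ind with
      | h g =>
        induction g' using Hom.ind with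
        | h g' =>
          change Hom.comp (toHom f) (toHom g + toHom g') =
            Hom.comp (toHom f) (toHom g) + Hom.comp (toHom f) (toHom g')
          simp only [← map_add, Hom.comp_toHom]

/-- Gluing the identity cobordism of `D` on top. -/
def whiskerLeft (D : Diagram n) {X Y : Diagram n} : (X ⟶ Y) →+ (D.glue X ⟶ D.glue Y) :=
  QuotientAddGroup.map (nullSubgroup X Y) (nullSubgroup (D.glue X) (D.glue Y))
    (Formal.glueLeft D) fun _ hf => Null.glueLeft D hf

/-- Gluing the identity cobordism of `D` below. -/
def whiskerRight (D : Diagram n) {X Y : Diagram n} : (X ⟶ Y) →+ (X.glue D ⟶ Y.glue D) :=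
  QuotientAddGroup.map (nullSubgroup X Y) (nullSubgroup (X.glue D) (Y.glue D))
    (Formal.glueRight D) fun _ hf => Null.glueRight D hf

theorem whiskerLeft_id (D X : Diagram n) : whiskerLeft D (𝟙 X) = 𝟙 (D.glue X) :=
  congrArg toHom (Formal.glueLeft_of D Movie.nil)

theorem whiskerRight_id (D X : Diagram n) : whiskerRight D (𝟙 X) = 𝟙 (X.glue D) :=
  congrArg toHom (Formal.glueRight_of D Movie.nil)

theorem whiskerLeft_comp (D : Diagram n) {X Y Z : Diagram n} (f : X ⟶ Y) (g : Y ⟶ Z) :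
    whiskerLeft D (f ≫ g) = whiskerLeft D f ≫ whiskerLeft D g := by
  induction f using Hom.ind with
  | h f =>
    induction g using Hom.ind with
    | h g => exact congrArg toHom (Formal.glueLeft_comp D f g)

theorem whiskerRight_comp (D : Diagram n) {X Y Z : Diagram n} (f : X ⟶ Y) (g : Y ⟶ Z) :
    whiskerRight D (f ≫ g) = whiskerRight D f ≫ whiskerRight D g := by
  induction f using Hom.ind with
  | h f =>
    induction g using Hom.ind with
    | h g => exact congrArg toHom (Formal.glueRight_comp D f g)

/-- The class of one elementary cobordism. -/
def ofMove {X Y : Diagram n} (m : Move X Y) : X ⟶ Y :=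
  toHom (Formal.ofMovie (Movie.nil.snoc m))

theorem hom_induction {X : Diagram n} (P : ∀ {Y : Diagram n}, (X ⟶ Y) → Prop)
    (id : P (𝟙 X)) (neg : ∀ {Y : Diagram n} (f : X ⟶ Y), P f → P (-f))
    (zero : ∀ Y : Diagram n, P (0 : X ⟶ Y))
    (add : ∀ {Y : Diagram n} (f g : X ⟶ Y), P f → P g → P (f + g))
    (comp : ∀ {Y Z : Diagram n} (f : X ⟶ Y) (m : Move Y Z), P f → P (f ≫ ofMove m))
    {Y : Diagram n} (f : X ⟶ Y) : P f := by
  have key : ∀ {Y : Diagram n} (p : Movie X Y), P (Y := Y) (toHom (Formal.ofMovie p)) := by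
    intro Y p
    induction p with
    | nil => exact id
    | snoc p m ih =>
      have h := comp _ m ih
      have e : Hom.comp (toHom (Formal.ofMovie p)) (toHom (Formal.ofMovie (Movie.nil.snoc m))) =
          toHom (Formal.ofMovie (p.snoc m)) :=
        congrArg toHom (Formal.comp_of p (Movie.nil.snoc m))
      exact e ▸ h
  induction f using Hom.ind with
  | h f =>
    induction f using FreeAbelianGroup.induction_on with
    | zero => exact zero Y
    | of p => exact key p
    | neg p ih => exact neg _ ih
    | add f g hf hg => exact add _ _ hf hg

theorem exchange {X X' Y Y' : Diagram n} (f : X ⟶ X') (g : Y ⟶ Y') :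
    whiskerRight Y f ≫ whiskerLeft X' g = whiskerLeft X g ≫ whiskerRight Y' f := by
  induction f using hom_induction with
  | zero X' => simp only [map_zero, Limits.zero_comp, Limits.comp_zero]
  | id => rw [whiskerRight_id, whiskerRight_id, Category.id_comp, Category.comp_id]
  | add f f' h h' => simp only [map_add, Preadditive.add_comp, Preadditive.comp_add, h, h']
  | neg f h => simp only [map_neg, Preadditive.neg_comp, Preadditive.comp_neg, h]
  | @comp X₁ X₂ f m h =>
    have key : whiskerRight Y (ofMove m) ≫ whiskerLeft X₂ g =
        whiskerLeft X₁ g ≫ whiskerRight Y' (ofMove m) := by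
      clear h
      induction g using hom_induction with
      | zero X' => simp only [map_zero, Limits.zero_comp, Limits.comp_zero]
      | id => rw [whiskerLeft_id, whiskerLeft_id, Category.id_comp, Category.comp_id]
      | add f f' h h' => simp only [map_add, Preadditive.add_comp, Preadditive.comp_add, h, h']
      | neg f h => simp only [map_neg, Preadditive.neg_comp, Preadditive.comp_neg, h]
      | @comp Y₁ Y₂ g k h =>
        have e : whiskerRight Y₁ (ofMove m) ≫ whiskerLeft X₂ (ofMove k) =
            whiskerLeft X₁ (ofMove k) ≫ whiskerRight Y₂ (ofMove m) :=
          toHom_eq_iff.mpr (Null.exchange m k)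
        rw [whiskerLeft_comp, whiskerLeft_comp, Category.assoc, reassoc_of% h, e]
    rw [whiskerRight_comp, whiskerRight_comp, Category.assoc, key, reassoc_of% h]

end Diagram

/-- Bar-Natan's dotted cobordism category of the disc with `2 n` boundary points, with `q`-graded
Temperley-Lieb diagrams as objects. -/
abbrev Cob (n : ℕ) : Type := Diagram n

/-- Gluing of diagrams and of cobordisms, as a bifunctor. -/
def gluing {n : ℕ} : Cob n ⥤ Cob n ⥤ Cob n where
  obj X :=
    { obj := fun Y => X.glue Y
      map := fun g => Diagram.whiskerLeft X g
      map_id := fun Y => Diagram.whiskerLeft_id X Y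
      map_comp := fun g g' => Diagram.whiskerLeft_comp X g g' }
  map f :=
    { app := fun Y => Diagram.whiskerRight Y f
      naturality := fun _ _ g => (Diagram.exchange f g).symm }
  map_id X := by
    ext Y
    exact Diagram.whiskerRight_id Y X
  map_comp f g := by
    ext Y
    exact Diagram.whiskerRight_comp Y f g

instance {n : ℕ} : (gluing (n := n)).Additive where
  map_add {X X' f g} := by
    ext Y
    exact map_add (Diagram.whiskerRight Y) f g

instance {n : ℕ} (X : Cob n) : ((gluing (n := n)).obj X).Additive where
  map_add {Y Y' f g} := map_add (Diagram.whiskerLeft X) f g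

section MatBifunctor

variable {C : Type} [Category.{0} C] [Preadditive C] (F : C ⥤ C ⥤ C) [F.Additive]
  [∀ X, (F.obj X).Additive]

/-- Entrywise application of a biadditive bifunctor to two matrices. -/
def matHom {M M' N N' : Mat_ C} (f : M ⟶ M') (g : N ⟶ N') :
    (⟨M.ι × N.ι, fun a => (F.obj (M.X a.1)).obj (N.X a.2)⟩ : Mat_ C) ⟶
      ⟨M'.ι × N'.ι, fun a => (F.obj (M'.X a.1)).obj (N'.X a.2)⟩ :=
  fun a b => (F.map (f a.1 b.1)).app (N.X a.2) ≫ (F.obj (M'.X b.1)).map (g a.2 b.2)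

theorem matHom_id (M N : Mat_ C) : matHom F (𝟙 M) (𝟙 N) = 𝟙 _ := by
  ext ⟨i, j⟩ ⟨i', j'⟩
  by_cases hi : i = i'
  · subst hi
    by_cases hj : j = j'
    · subst hj
      simp [matHom]
    · rw [Mat_.id_apply_of_ne _ _ _ (by simpa using hj)]
      simp [matHom, Mat_.id_apply_of_ne _ _ _ hj]
  · rw [Mat_.id_apply_of_ne _ _ _ (by simp [hi])]
    simp [matHom, Mat_.id_apply_of_ne _ _ _ hi]

theorem matHom_comp {M M' M'' N N' N'' : Mat_ C} (f : M ⟶ M') (f' : M' ⟶ M'')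
    (g : N ⟶ N') (g' : N' ⟶ N'') :
    matHom F (f ≫ f') (g ≫ g') = matHom F f g ≫ matHom F f' g' := by
  ext ⟨i, j⟩ ⟨i', j'⟩
  simp only [matHom, Mat_.comp_apply, Fintype.sum_prod_type, Functor.map_sum, NatTrans.app_sum,
    Preadditive.sum_comp, Preadditive.comp_sum, Functor.map_comp, NatTrans.comp_app,
    Category.assoc, NatTrans.naturality_assoc]
  exact Finset.sum_comm

/-- The extension of a biadditive bifunctor to formal direct sums. -/
noncomputable def matBifunctor : Mat_ C ⥤ Mat_ C ⥤ Mat_ C where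
  obj M :=
    { obj := fun N => ⟨M.ι × N.ι, fun a => (F.obj (M.X a.1)).obj (N.X a.2)⟩
      map := fun g => matHom F (𝟙 M) g
      map_id := fun N => matHom_id F M N
      map_comp := fun g g' => by rw [← matHom_comp, Category.id_comp] }
  map f :=
    { app := fun N => matHom F f (𝟙 N)
      naturality := fun N N' g => by
        dsimp only
        rw [← matHom_comp, ← matHom_comp]
        simp only [Category.id_comp, Category.comp_id] }
  map_id M := by
    ext N : 2
    exact matHom_id F M N
  map_comp f f' := by
    ext N : 2
    exact (congrArg (matHom F (f ≫ f')) (Category.id_comp (𝟙 N)).symm).trans (matHom_comp F _ _ _ _)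

instance : (matBifunctor F).Additive where
  map_add {M M' f g} := by
    ext N : 2
    ext a b
    change _ = matHom F f (𝟙 N) a b + matHom F g (𝟙 N) a b
    simp [matBifunctor, matHom]

instance (M : Mat_ C) : ((matBifunctor F).obj M).Additive where
  map_add {N N' f g} := by
    ext a b
    change _ = matHom F (𝟙 M) f a b + matHom F (𝟙 M) g a b
    simp [matBifunctor, matHom]

end MatBifunctor

/-- The usual Koszul signs for the total complex of cochain complexes indexed by `ℕ`. -/
instance : (ComplexShape.up ℕ).TensorSigns where
  ε' := MonoidHom.mk' (fun i : ℕ => (-1 : ℤˣ) ^ i) (pow_add (-1 : ℤˣ))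
  rel_add p q r (h : p + 1 = q) := by change p + r + 1 = q + r; omega
  add_rel p q r (h : p + 1 = q) := by change r + p + 1 = r + q; omega
  ε'_succ := by
    rintro p _ rfl
    change (-1 : ℤˣ) ^ (p + 1) = - (-1 : ℤˣ) ^ p
    rw [pow_succ, mul_neg, mul_one]

/-- Chain complexes of formal direct sums of diagrams, with differentials of degree zero that raise the
homological degree; complexes are supported in homological degrees `≥ 0`. -/
abbrev Kom (n : ℕ) : Type 1 := CochainComplex (Mat_ (Cob n)) ℕ

namespace Kom

variable {n : ℕ}

instance (C D : Kom n) : HomologicalComplex.HasMapBifunctor C D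
    (matBifunctor (gluing (n := n))) (ComplexShape.up ℕ) := by
  intro k
  have : Finite ((ComplexShape.π (ComplexShape.up ℕ) (ComplexShape.up ℕ) (ComplexShape.up ℕ)) ⁻¹' {k}) := by
    apply Set.Finite.subset ((Set.finite_Iic k).prod (Set.finite_Iic k))
    rintro ⟨p, q⟩ h
    have h : p + q = k := h
    constructor <;> simp <;> omega
  infer_instance

/-- The tensor product obtained by gluing all diagrams and morphisms: the total complex of the double
complex with entries `C i ⊗ D j`, with differential `d ⊗ 1 + (-1) ^ i (1 ⊗ d)`. -/
noncomputable def tensor (C D : Kom n) : Kom n :=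
  HomologicalComplex.mapBifunctor C D (matBifunctor (gluing (n := n))) (ComplexShape.up ℕ)

/-- A diagram as a complex in homological degree `0`. -/
noncomputable def single (X : Diagram n) : Kom n :=
  (CochainComplex.single₀ (Mat_ (Cob n))).obj ((Mat_.embedding (Cob n)).obj X)
end Kom

namespace Movie

variable {n : ℕ} {K : Type}

/-- Relabelling by an injection does not change weights. -/
theorem weight_comp_injective (wt : LocalMove → ℤ) {K' : Type} (e : K → K')
    (he : Function.Injective e) (k : K) {X Y : Diagram n} (p : Movie X Y) (f : Node p → K) :
    weight wt (e k) p (fun a => e (f a)) = weight wt k p f := by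
  induction p with
  | nil => rfl
  | snoc p m ih =>
    refine congrArg₂ (· + ·) (ih fun a => f (Sum.inl a)) ?_
    have h : (∃ s, m.IsSite s ∧ e (f (Sum.map (last p) id s)) = e k) ↔
        ∃ s, m.IsSite s ∧ f (Sum.map (last p) id s) = k :=
      exists_congr fun s => and_congr_right fun _ => he.eq_iff
    by_cases hs : ∃ s, m.IsSite s ∧ f (Sum.map (last p) id s) = k
    · exact (if_pos (h.mpr hs)).trans (if_pos hs).symm
    · exact (if_neg (mt h.mp hs)).trans (if_neg hs).symm

/-- Every component of the movie meets its first frame. -/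
def Supported {X Y : Diagram n} (p : Movie X Y) : Prop :=
  ∀ a : Node p, ∃ x, toComponent p a = toComponent p (first p x)

theorem supported_nil (X : Diagram n) : Supported (nil : Movie X X) := fun a => ⟨a, rfl⟩

theorem mk_inl {X Y Z : Diagram n} {p : Movie X Y} (m : Move Y Z) {a b : Node p}
    (h : toComponent p a = toComponent p b) :
    toComponent (p.snoc m) (Sum.inl a) = toComponent (p.snoc m) (Sum.inl b) := by
  have := congrArg (Quot.lift (fun a => Quot.mk (Adjacent (p.snoc m)) (Sum.inl a))
    fun a b h => Quot.sound h) h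
  exact this

theorem Supported.snoc {X Y Z : Diagram n} {p : Movie X Y} (hp : Supported p) (m : Move Y Z)
    (hm : ∀ z : Z.Vertex, ∃ y, m.Tracks y z) : Supported (p.snoc m) := by
  rintro (a | z)
  · obtain ⟨x, hx⟩ := hp a
    exact ⟨x, mk_inl m hx⟩
  · obtain ⟨y, hy⟩ := hm z
    obtain ⟨x, hx⟩ := hp (last p y)
    refine ⟨x, Eq.trans (Eq.symm (Quot.sound ?_)) (mk_inl m hx)⟩
    exact ⟨y, rfl, hy⟩

theorem sameSurface_of_labels {X Y : Diagram n} {p q : Movie X Y} (f : Node p → K)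
    (g : Node q → K) (hf : ∀ a b, Adjacent p a b → f a = f b)
    (hg : ∀ a b, Adjacent q a b → g a = g b) (hp : Supported p) (hq : Supported q)
    (hfirst : ∀ x, f (first p x) = g (first q x)) (hlast : ∀ y, f (last p y) = g (last q y))
    (hfi : ∀ x x', f (first p x) = f (first p x') →
      toComponent p (first p x) = toComponent p (first p x'))
    (hgi : ∀ x x', g (first q x) = g (first q x') →
      toComponent q (first q x) = toComponent q (first q x'))
    (he : ∀ k, weight LocalMove.euler k p f = weight LocalMove.euler k q g)
    (hd : ∀ k, weight (fun m => m.dots) k p f = weight (fun m => m.dots) k q g) :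
    SameSurface p q := by
  let F : Component p → K := Quot.lift f hf
  let G : Component q → K := Quot.lift g hg
  have hF : Function.Injective F := by
    rintro ⟨a⟩ ⟨b⟩ h
    obtain ⟨x, hx⟩ := hp a
    obtain ⟨x', hx'⟩ := hp b
    change F (toComponent p a) = F (toComponent p b) at h
    rw [hx, hx'] at h
    exact hx.trans ((hfi x x' h).trans hx'.symm)
  have hG : Function.Injective G := by
    rintro ⟨a⟩ ⟨b⟩ h
    obtain ⟨x, hx⟩ := hq a
    obtain ⟨x', hx'⟩ := hq b
    change G (toComponent q a) = G (toComponent q b) at h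
    rw [hx, hx'] at h
    exact hx.trans ((hgi x x' h).trans hx'.symm)
  have hr : Set.range F = Set.range G := by
    ext k
    constructor
    · rintro ⟨⟨a⟩, rfl⟩
      obtain ⟨x, hx⟩ := hp a
      exact ⟨toComponent q (first q x), (hfirst x).symm.trans (congrArg F hx).symm⟩
    · rintro ⟨⟨a⟩, rfl⟩
      obtain ⟨x, hx⟩ := hq a
      exact ⟨toComponent p (first p x), (hfirst x).trans (congrArg G hx).symm⟩
  let φ : Component p ≃ Component q :=
    ((Equiv.ofInjective F hF).trans (Equiv.setCongr hr)).trans (Equiv.ofInjective G hG).symm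
  have hφ : ∀ c, G (φ c) = F c := fun c =>
    Equiv.apply_ofInjective_symm hG ((Equiv.setCongr hr) (Equiv.ofInjective F hF c))
  refine ⟨φ, fun x => hG ((hφ _).trans (hfirst x)), fun y => hG ((hφ _).trans (hlast y)),
    fun c => ?_, fun c => ?_⟩
  · refine (weight_comp_injective _ F hF c p (toComponent p)).symm.trans ((he _).trans ?_)
    rw [← hφ]
    exact weight_comp_injective _ G hG (φ c) q (toComponent q)
  · refine (weight_comp_injective _ F hF c p (toComponent p)).symm.trans ((hd _).trans ?_)
    rw [← hφ]
    exact weight_comp_injective _ G hG (φ c) q (toComponent q)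

end Movie


namespace Movie

variable {n : ℕ} {K : Type}

theorem toComponent_first_eq {X Y : Diagram n} (p : Movie X Y) {x x' : X.Vertex}
    (h : X.Joined x x') : toComponent p (first p x) = toComponent p (first p x') := by
  induction p with
  | nil => exact Quot.sound h
  | snoc p m ih => exact mk_inl m ih

/-- A labelling of the nodes of a movie that is constant on components and restricts to the given
labels at the two ends. -/
structure IsLabelling {X Y : Diagram n} (p : Movie X Y) (l l' : ℕ × ℕ → K) (f : Node p → K) :
    Prop where
  adj : ∀ a b, Adjacent p a b → f a = f b
  first : ∀ x, f (first p x) = l x.1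
  last : ∀ y, f (last p y) = l' y.1
  supported : Supported p

theorem IsLabelling.nil {X : Diagram n} (l : ℕ × ℕ → K)
    (h : ∀ x y : X.Vertex, X.Joined x y → l x.1 = l y.1) :
    IsLabelling (nil : Movie X X) l l (fun x : X.Vertex => l x.1) :=
  ⟨h, fun _ => rfl, fun _ => rfl, supported_nil X⟩

theorem IsLabelling.snoc {X Y Z : Diagram n} {p : Movie X Y} {l l' : ℕ × ℕ → K}
    {f : Node p → K} (h : IsLabelling p l l' f) (m : Move Y Z) (l'' : ℕ × ℕ → K)
    (hj : ∀ x y : Z.Vertex, Z.Joined x y → l'' x.1 = l'' y.1)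
    (ht : ∀ (y : Y.Vertex) (z : Z.Vertex), m.Tracks y z → l' y.1 = l'' z.1)
    (hs : ∀ z : Z.Vertex, ∃ y, m.Tracks y z) :
    IsLabelling (p.snoc m) l l'' (Sum.elim f fun z : Z.Vertex => l'' z.1) where
  adj := by
    rintro (a | z) (b | z') hab
    · exact h.adj a b hab
    · obtain ⟨y, hy, hyz⟩ := hab
      exact (congrArg f hy).trans ((h.last y).trans (ht y z' hyz))
    · exact hab.elim
    · exact hj z z' hab
  first := h.first
  last := fun _ => rfl
  supported := h.supported.snoc m hs

open Classical in
theorem IsLabelling.weight_snoc {X Y Z : Diagram n} {p : Movie X Y} {l l' : ℕ × ℕ → K}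
    {f : Node p → K} (h : IsLabelling p l l' f) (m : Move Y Z) (g : Z.Vertex → K)
    (wt : LocalMove → ℤ) (k : K) (c : Y.Vertex) (hc : ∀ s, m.IsSite s ↔ s = Sum.inl c) :
    weight wt k (p.snoc m) (Sum.elim f g) =
      weight wt k p f + if l' c.1 = k then wt m.loc else 0 := by
  refine congrArg₂ (· + ·) rfl ?_
  have e : (∃ s, m.IsSite s ∧ (Sum.elim f g) (Sum.map (Movie.last p) id s) = k) ↔ l' c.1 = k := by
    simp only [hc, exists_eq_left]
    exact Eq.congr_left (h.last c)
  by_cases hk : l' c.1 = k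
  · exact (if_pos (e.mpr hk)).trans (if_pos hk).symm
  · exact (if_neg (mt e.mp hk)).trans (if_neg hk).symm

theorem IsLabelling.sameSurface {X Y : Diagram n} {p q : Movie X Y} {l l' : ℕ × ℕ → K}
    {f : Node p → K} {g : Node q → K} (hf : IsLabelling p l l' f) (hg : IsLabelling q l l' g)
    (hp : ∀ x x' : X.Vertex, l x.1 = l x'.1 →
      toComponent p (Movie.first p x) = toComponent p (Movie.first p x'))
    (hq : ∀ x x' : X.Vertex, l x.1 = l x'.1 →
      toComponent q (Movie.first q x) = toComponent q (Movie.first q x'))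
    (he : ∀ k, weight LocalMove.euler k p f = weight LocalMove.euler k q g)
    (hd : ∀ k, weight (fun m => m.dots) k p f = weight (fun m => m.dots) k q g) :
    SameSurface p q := by
  refine sameSurface_of_labels f g hf.adj hg.adj hf.supported hg.supported
    (fun x => (hf.first x).trans (hg.first x).symm) (fun y => (hf.last y).trans (hg.last y).symm)
    (fun x x' h => hp x x' ?_) (fun x x' h => hq x x' ?_) he hd
  · rwa [hf.first, hf.first] at h
  · rwa [hg.first, hg.first] at h

end Movie

/-- The identity diagram with two vertical strands, in `q`-degree `a`. -/
def identityDiagram (a : ℤ) : Cob 2 := ⟨[], rfl, a⟩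
/-- The turnback diagram (the two upper end points joined, and the two lower ones), in `q`-degree `a`. -/
def turnback (a : ℤ) : Cob 2 := ⟨[.cup 0, .cap 0], rfl, a⟩
/-- Two turnbacks glued: a turnback with a circle between its arcs, in `q`-degree `a`. -/
def turnback₂ (a : ℤ) : Cob 2 := ⟨[.cup 0, .cap 0, .cup 0, .cap 0], rfl, a⟩

/-- The saddle from the identity diagram to the turnback. -/
def saddleMove (a b : ℤ) (h : b = a + 1) : Move (identityDiagram a) (turnback b) where
  pre := []
  post := []
  loc := .saddle 0
  source_eq := rfl
  target_eq := rfl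
  dot_mem := nofun
  deg_eq := by subst h; simp [LocalMove.degree, LocalMove.euler, LocalMove.dots, identityDiagram, turnback]

/-- The dot on the upper sheet of the turnback. -/
def topDotMove (a b : ℤ) (h : b = a + 2) : Move (turnback a) (turnback b) where
  pre := []
  post := [.cup 0, .cap 0]
  loc := .dot 0
  source_eq := rfl
  target_eq := rfl
  dot_mem := by rintro j ⟨⟩; exact ⟨2, rfl, by norm_num⟩
  deg_eq := by
    subst h; simp [LocalMove.degree, LocalMove.euler, LocalMove.dots, turnback]; try ring

/-- The dot on the lower sheet of the turnback. -/
def bottomDotMove (a b : ℤ) (h : b = a + 2) : Move (turnback a) (turnback b) where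
  pre := [.cup 0, .cap 0]
  post := []
  loc := .dot 0
  source_eq := rfl
  target_eq := rfl
  dot_mem := by rintro j ⟨⟩; exact ⟨2, rfl, by norm_num⟩
  deg_eq := by
    subst h; simp [LocalMove.degree, LocalMove.euler, LocalMove.dots, turnback]; try ring

/-- The dot on the circle between the arcs. -/
def circleDotMove (a b : ℤ) (h : b = a + 2) : Move (turnback₂ a) (turnback₂ b) where
  pre := [.cup 0, .cap 0]
  post := [.cup 0, .cap 0]
  loc := .dot 0
  source_eq := rfl
  target_eq := rfl
  dot_mem := by rintro j ⟨⟩; exact ⟨2, rfl, by norm_num⟩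
  deg_eq := by
    subst h; simp [LocalMove.degree, LocalMove.euler, LocalMove.dots, turnback₂]; try ring

/-- The saddle that splits a circle off the upper arc. -/
def splitTopMove (a b : ℤ) (h : b = a + 1) : Move (turnback a) (turnback₂ b) where
  pre := []
  post := [.cup 0, .cap 0]
  loc := .saddle 0
  source_eq := rfl
  target_eq := rfl
  dot_mem := nofun
  deg_eq := by
    subst h; simp [LocalMove.degree, LocalMove.euler, LocalMove.dots, turnback, turnback₂]; try ring

/-- The saddle that splits a circle off the lower arc. -/
def splitBottomMove (a b : ℤ) (h : b = a + 1) : Move (turnback a) (turnback₂ b) where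
  pre := [.cup 0, .cap 0]
  post := []
  loc := .saddle 0
  source_eq := rfl
  target_eq := rfl
  dot_mem := nofun
  deg_eq := by
    subst h; simp [LocalMove.degree, LocalMove.euler, LocalMove.dots, turnback, turnback₂]; try ring

/-- The birth of the circle between the arcs. -/
def circleBirthMove (a b : ℤ) (h : a = b + 1) : Move (turnback a) (turnback₂ b) where
  pre := [.cup 0]
  post := [.cap 0]
  loc := .birth 0
  source_eq := rfl
  target_eq := rfl
  dot_mem := nofun
  deg_eq := by
    subst h; simp [LocalMove.degree, LocalMove.euler, LocalMove.dots, turnback, turnback₂]; try ring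

/-- The death of the circle between the arcs. -/
def circleDeathMove (a b : ℤ) (h : a = b + 1) : Move (turnback₂ a) (turnback b) where
  pre := [.cup 0]
  post := [.cap 0]
  loc := .death 0
  source_eq := rfl
  target_eq := rfl
  dot_mem := nofun
  deg_eq := by
    subst h; simp [LocalMove.degree, LocalMove.euler, LocalMove.dots, turnback, turnback₂]; try ring

open Diagram

theorem turnback_vertex {a : ℤ} (x : (turnback a).Vertex) :
    x.1 = (0, 0) ∨ x.1 = (0, 1) ∨ x.1 = (2, 0) ∨ x.1 = (2, 1) := by
  obtain ⟨⟨t, j⟩, h1, h2⟩ := x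
  simp only [turnback, List.length_cons, List.length_nil] at h1
  interval_cases t
  all_goals
    simp [turnback, strands, endWidth, Letter.width] at h2
  all_goals
    interval_cases j <;> simp

theorem turnback₂_vertex {a : ℤ} (x : (turnback₂ a).Vertex) :
    x.1 = (0, 0) ∨ x.1 = (0, 1) ∨ x.1 = (2, 0) ∨ x.1 = (2, 1) ∨ x.1 = (4, 0) ∨ x.1 = (4, 1) := by
  obtain ⟨⟨t, j⟩, h1, h2⟩ := x
  simp only [turnback₂, List.length_cons, List.length_nil] at h1
  interval_cases t
  all_goals
    simp [turnback₂, strands, endWidth, Letter.width] at h2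
  all_goals
    interval_cases j <;> simp


theorem turnback_label (a : ℤ) {K : Type} (l : ℕ × ℕ → K) (h0 : l (0, 0) = l (0, 1))
    (h2 : l (2, 0) = l (2, 1)) (x y : (turnback a).Vertex) (h : (turnback a).Joined x y) :
    l x.1 = l y.1 := by
  obtain ⟨t, b, p, q, ht, hs, hx, hy⟩ := h
  rw [hx, hy]
  have hx' := turnback_vertex x
  have hy' := turnback_vertex y
  rw [hx] at hx'
  rw [hy] at hy'
  match t with
  | 0 =>
    simp [turnback] at ht; subst ht
    cases hs <;> simp_all
  | 1 =>
    simp [turnback] at ht; subst ht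
    cases hs <;> simp_all
  | t + 2 => simp [turnback] at ht

theorem turnback₂_label (a : ℤ) {K : Type} (l : ℕ × ℕ → K) (h0 : l (0, 0) = l (0, 1))
    (h2 : l (2, 0) = l (2, 1)) (h4 : l (4, 0) = l (4, 1)) (x y : (turnback₂ a).Vertex)
    (h : (turnback₂ a).Joined x y) :
    l x.1 = l y.1 := by
  obtain ⟨t, b, p, q, ht, hs, hx, hy⟩ := h
  rw [hx, hy]
  have hx' := turnback₂_vertex x
  have hy' := turnback₂_vertex y
  rw [hx] at hx'
  rw [hy] at hy'
  match t with
  | 0 | 1 | 2 | 3 =>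
    simp [turnback₂] at ht; subst ht
    cases hs <;> simp_all
  | t + 4 => simp [turnback₂] at ht

/-- Labels separating the upper arc from the lower arc of the turnback. -/
def upper (x : ℕ × ℕ) : Bool := decide (x.1 < 1)
/-- Labels separating the lowest arc from the rest. -/
def upperTwo (x : ℕ × ℕ) : Bool := decide (x.1 < 3)

theorem turnback_joined {a : ℤ} (x x' : (turnback a).Vertex) (h : x.1.1 = x'.1.1) :
    x = x' ∨ (turnback a).Joined x x' ∨ (turnback a).Joined x' x := by
  have key : ∀ x x' : (turnback a).Vertex, x.1 = (0, 0) → x'.1 = (0, 1) →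
      (turnback a).Joined x x' := fun x x' hx hx' =>
    ⟨0, .cup 0, (0, 0), (0, 1), rfl, .cup_turn 0, hx, hx'⟩
  have key' : ∀ x x' : (turnback a).Vertex, x.1 = (2, 0) → x'.1 = (2, 1) →
      (turnback a).Joined x x' := fun x x' hx hx' =>
    ⟨1, .cap 0, (1, 0), (1, 1), rfl, .cap_turn 0, hx, hx'⟩
  rcases turnback_vertex x with hx | hx | hx | hx <;>
    rcases turnback_vertex x' with hx' | hx' | hx' | hx' <;>
    first
    | exact Or.inl (Subtype.ext (hx.trans hx'.symm))
    | exact Or.inr (Or.inl (key x x' hx hx'))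
    | exact Or.inr (Or.inr (key x' x hx' hx))
    | exact Or.inr (Or.inl (key' x x' hx hx'))
    | exact Or.inr (Or.inr (key' x' x hx' hx))
    | (rw [hx, hx'] at h; simp at h)

theorem turnback_first {a : ℤ} {Y : Diagram 2} (p : Movie (turnback a) Y)
    (x x' : (turnback a).Vertex) (h : upper x.1 = upper x'.1) :
    Movie.toComponent p (Movie.first p x) = Movie.toComponent p (Movie.first p x') := by
  have h : x.1.1 = x'.1.1 := by
    rcases turnback_vertex x with hx | hx | hx | hx <;>
      rcases turnback_vertex x' with hx' | hx' | hx' | hx' <;>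
      rw [hx, hx'] at h ⊢ <;> simp [upper] at h ⊢
  rcases turnback_joined x x' h with rfl | h | h
  · rfl
  · exact Movie.toComponent_first_eq p h
  · exact (Movie.toComponent_first_eq p h).symm

theorem lab_topDot {a b : ℤ} {X : Diagram 2} {p : Movie X (turnback a)} {l : ℕ × ℕ → Bool}
    {f : Movie.Node p → Bool} (h : Movie.IsLabelling p l upper f) (hab : b = a + 2) :
    Movie.IsLabelling (p.snoc (topDotMove a b hab)) l upper (Sum.elim f fun z => upper z.1) := by
  apply h.snoc
  · exact turnback_label b upper rfl rfl
  · intro y z h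
    rcases turnback_vertex y with hy | hy | hy | hy <;>
      rcases turnback_vertex z with hz | hz | hz | hz <;> 
      simp [Move.Tracks, topDotMove, hy, hz, upper, LocalMove.source, LocalMove.target] at h ⊢
  · intro z
    refine ⟨z, ?_⟩
    rcases turnback_vertex z with hz | hz | hz | hz <;>
      simp [Move.Tracks, topDotMove, hz, LocalMove.source, LocalMove.target]

theorem lab_bottomDot {a b : ℤ} {X : Diagram 2} {p : Movie X (turnback a)} {l : ℕ × ℕ → Bool}
    {f : Movie.Node p → Bool} (h : Movie.IsLabelling p l upper f) (hab : b = a + 2) :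
    Movie.IsLabelling (p.snoc (bottomDotMove a b hab)) l upper (Sum.elim f fun z => upper z.1) := by
  apply h.snoc
  · exact turnback_label b upper rfl rfl
  · intro y z h
    rcases turnback_vertex y with hy | hy | hy | hy <;>
      rcases turnback_vertex z with hz | hz | hz | hz <;>
      simp [Move.Tracks, bottomDotMove, hy, hz, upper, LocalMove.source, LocalMove.target] at h ⊢
  · intro z
    refine ⟨z, ?_⟩
    rcases turnback_vertex z with hz | hz | hz | hz <;>
      simp [Move.Tracks, bottomDotMove, hz, LocalMove.source, LocalMove.target]


def v00 (a : ℤ) : (turnback a).Vertex :=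
  ⟨(0, 0), by simp [turnback], by simp [turnback, strands, endWidth]⟩
def v20 (a : ℤ) : (turnback a).Vertex :=
  ⟨(2, 0), by simp [turnback], by simp [turnback, strands, endWidth, Letter.width]⟩
def v01 (a : ℤ) : (turnback a).Vertex :=
  ⟨(0, 1), by simp [turnback], by simp [turnback, strands, endWidth]⟩
def v21 (a : ℤ) : (turnback a).Vertex :=
  ⟨(2, 1), by simp [turnback], by simp [turnback, strands, endWidth, Letter.width]⟩
def w00 (a : ℤ) : (turnback₂ a).Vertex :=
  ⟨(0, 0), by simp [turnback₂], by simp [turnback₂, strands, endWidth]⟩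
def w01 (a : ℤ) : (turnback₂ a).Vertex :=
  ⟨(0, 1), by simp [turnback₂], by simp [turnback₂, strands, endWidth]⟩
def w20 (a : ℤ) : (turnback₂ a).Vertex :=
  ⟨(2, 0), by simp [turnback₂], by simp [turnback₂, strands, endWidth, Letter.width]⟩
def w21 (a : ℤ) : (turnback₂ a).Vertex :=
  ⟨(2, 1), by simp [turnback₂], by simp [turnback₂, strands, endWidth, Letter.width]⟩
def w40 (a : ℤ) : (turnback₂ a).Vertex :=
  ⟨(4, 0), by simp [turnback₂], by simp [turnback₂, strands, endWidth, Letter.width]⟩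
def w41 (a : ℤ) : (turnback₂ a).Vertex :=
  ⟨(4, 1), by simp [turnback₂], by simp [turnback₂, strands, endWidth, Letter.width]⟩

theorem lab_splitTop {a b : ℤ} {X : Diagram 2} {p : Movie X (turnback a)} {l : ℕ × ℕ → Bool}
    {f : Movie.Node p → Bool} (h : Movie.IsLabelling p l upper f) (hab : b = a + 1) :
    Movie.IsLabelling (p.snoc (splitTopMove a b hab)) l upperTwo (Sum.elim f fun z => upperTwo z.1) := by
  apply h.snoc
  · exact turnback₂_label b upperTwo rfl rfl rfl
  · intro y z h
    rcases turnback_vertex y with hy | hy | hy | hy <;>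
      rcases turnback₂_vertex z with hz | hz | hz | hz | hz | hz <;>
      simp [Move.Tracks, splitTopMove, hy, hz, upper, upperTwo, LocalMove.source, LocalMove.target] at h ⊢
  · intro z
    rcases turnback₂_vertex z with hz | hz | hz | hz | hz | hz
    · exact ⟨v00 a, Or.inl ⟨Nat.le_refl 0, hz⟩⟩
    · exact ⟨v01 a, Or.inl ⟨Nat.le_refl 0, hz⟩⟩
    · exact ⟨v00 a, Or.inr ⟨Nat.le_refl 0, by rw [hz]; rfl, by rw [hz]; rfl⟩⟩
    · exact ⟨v01 a, Or.inr ⟨Nat.le_refl 0, by rw [hz]; rfl, by rw [hz]; rfl⟩⟩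
    · exact ⟨v20 a, Or.inr ⟨Nat.zero_le 2, by rw [hz]; rfl, by rw [hz]; rfl⟩⟩
    · exact ⟨v21 a, Or.inr ⟨Nat.zero_le 2, by rw [hz]; rfl, by rw [hz]; rfl⟩⟩

theorem lab_splitBottom {a b : ℤ} {X : Diagram 2} {p : Movie X (turnback a)} {l : ℕ × ℕ → Bool}
    {f : Movie.Node p → Bool} (h : Movie.IsLabelling p l upper f) (hab : b = a + 1) :
    Movie.IsLabelling (p.snoc (splitBottomMove a b hab)) l upper (Sum.elim f fun z => upper z.1) := by
  apply h.snoc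
  · exact turnback₂_label b upper rfl rfl rfl
  · intro y z h
    rcases turnback_vertex y with hy | hy | hy | hy <;>
      rcases turnback₂_vertex z with hz | hz | hz | hz | hz | hz <;>
      simp [Move.Tracks, splitBottomMove, hy, hz, upper, LocalMove.source, LocalMove.target] at h ⊢
  · intro z
    rcases turnback₂_vertex z with hz | hz | hz | hz | hz | hz
    · exact ⟨v00 a, Or.inl ⟨Nat.zero_le 2, hz⟩⟩
    · exact ⟨v01 a, Or.inl ⟨Nat.zero_le 2, hz⟩⟩
    · exact ⟨v20 a, Or.inl ⟨Nat.le_refl 2, hz⟩⟩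
    · exact ⟨v21 a, Or.inl ⟨Nat.le_refl 2, hz⟩⟩
    · exact ⟨v20 a, Or.inr ⟨Nat.le_refl 2, by rw [hz]; rfl, by rw [hz]; rfl⟩⟩
    · exact ⟨v21 a, Or.inr ⟨Nat.le_refl 2, by rw [hz]; rfl, by rw [hz]; rfl⟩⟩

theorem lab_circleDot {a b : ℤ} {X : Diagram 2} {p : Movie X (turnback₂ a)} {l l' : ℕ × ℕ → Bool}
    {f : Movie.Node p → Bool} (h : Movie.IsLabelling p l l' f) (hab : b = a + 2)
    (h0 : l' (0, 0) = l' (0, 1)) (h2 : l' (2, 0) = l' (2, 1)) (h4 : l' (4, 0) = l' (4, 1)) :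
    Movie.IsLabelling (p.snoc (circleDotMove a b hab)) l l' (Sum.elim f fun z => l' z.1) := by
  apply h.snoc
  · exact turnback₂_label b l' h0 h2 h4
  · intro y z h
    rcases turnback₂_vertex y with hy | hy | hy | hy | hy | hy <;>
      rcases turnback₂_vertex z with hz | hz | hz | hz | hz | hz <;>
      simp [Move.Tracks, circleDotMove, hy, hz, LocalMove.source, LocalMove.target] at h ⊢
  · intro z
    refine ⟨z, ?_⟩
    rcases turnback₂_vertex z with hz | hz | hz | hz | hz | hz <;>
      simp [Move.Tracks, circleDotMove, hz, LocalMove.source, LocalMove.target]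

theorem lab_death {a b : ℤ} {X : Diagram 2} {p : Movie X (turnback₂ a)} {l l' : ℕ × ℕ → Bool}
    {f : Movie.Node p → Bool} (h : Movie.IsLabelling p l l' f) (hab : a = b + 1)
    (h0 : l' (0, 0) = true) (h0' : l' (0, 1) = true)
    (h4 : l' (4, 0) = false) (h4' : l' (4, 1) = false) :
    Movie.IsLabelling (p.snoc (circleDeathMove a b hab)) l upper (Sum.elim f fun z => upper z.1) := by
  apply h.snoc
  · exact turnback_label b upper rfl rfl
  · intro y z h
    rcases turnback₂_vertex y with hy | hy | hy | hy | hy | hy <;>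
      rcases turnback_vertex z with hz | hz | hz | hz <;>
      simp [Move.Tracks, circleDeathMove, hy, hz, LocalMove.source, LocalMove.target, upper] at h ⊢ <;>
      assumption
  · intro z
    rcases turnback_vertex z with hz | hz | hz | hz
    · exact ⟨w00 a, Or.inl ⟨Nat.zero_le 1, hz⟩⟩
    · exact ⟨w01 a, Or.inl ⟨Nat.zero_le 1, hz⟩⟩
    · exact ⟨w40 a, Or.inr ⟨by simp [w40, circleDeathMove, LocalMove.source],
        by rw [hz]; rfl, by rw [hz]; rfl⟩⟩
    · exact ⟨w41 a, Or.inr ⟨by simp [w41, circleDeathMove, LocalMove.source],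
        by rw [hz]; rfl, by rw [hz]; rfl⟩⟩

theorem lab_nil (a : ℤ) : Movie.IsLabelling (Movie.nil : Movie (turnback a) (turnback a)) upper upper
    (fun x : (turnback a).Vertex => upper x.1) :=
  Movie.IsLabelling.nil upper (turnback_label a upper rfl rfl)

theorem site_topDot (a b : ℤ) (h : b = a + 2) (s) :
    (topDotMove a b h).IsSite s ↔ s = Sum.inl (v00 a) :=
  ⟨fun ⟨_, hs, hx⟩ => hs.trans (congrArg Sum.inl (Subtype.ext hx)), fun hs => ⟨_, hs, rfl⟩⟩

theorem site_bottomDot (a b : ℤ) (h : b = a + 2) (s) :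
    (bottomDotMove a b h).IsSite s ↔ s = Sum.inl (v20 a) :=
  ⟨fun ⟨_, hs, hx⟩ => hs.trans (congrArg Sum.inl (Subtype.ext hx)), fun hs => ⟨_, hs, rfl⟩⟩

theorem site_circleDot (a b : ℤ) (h : b = a + 2) (s) :
    (circleDotMove a b h).IsSite s ↔ s = Sum.inl (w20 a) :=
  ⟨fun ⟨_, hs, hx⟩ => hs.trans (congrArg Sum.inl (Subtype.ext hx)), fun hs => ⟨_, hs, rfl⟩⟩

theorem site_splitTop (a b : ℤ) (h : b = a + 1) (s) :
    (splitTopMove a b h).IsSite s ↔ s = Sum.inl (v00 a) :=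
  ⟨fun ⟨_, hs, hx⟩ => hs.trans (congrArg Sum.inl (Subtype.ext hx)), fun hs => ⟨_, hs, rfl⟩⟩

theorem site_splitBottom (a b : ℤ) (h : b = a + 1) (s) :
    (splitBottomMove a b h).IsSite s ↔ s = Sum.inl (v20 a) :=
  ⟨fun ⟨_, hs, hx⟩ => hs.trans (congrArg Sum.inl (Subtype.ext hx)), fun hs => ⟨_, hs, rfl⟩⟩

theorem site_circleDeath (a b : ℤ) (h : a = b + 1) (s) :
    (circleDeathMove a b h).IsSite s ↔ s = Sum.inl (w20 a) :=
  ⟨fun ⟨_, hs, hx⟩ => hs.trans (congrArg Sum.inl (Subtype.ext hx)), fun hs => ⟨_, hs, rfl⟩⟩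

theorem ofMove_comp_ofMove {n : ℕ} {X Y Z : Diagram n} (m : Move X Y) (k : Move Y Z) :
    ofMove m ≫ ofMove k = toHom (Formal.ofMovie ((Movie.nil.snoc m).snoc k)) :=
  congrArg toHom (Formal.comp_of _ _)

theorem ofMove_comp_toHom {n : ℕ} {X Y Z : Diagram n} (m : Move X Y) (p : Movie Y Z) :
    ofMove m ≫ toHom (Formal.ofMovie p) = toHom (Formal.ofMovie ((Movie.nil.snoc m).comp p)) :=
  congrArg toHom (Formal.comp_of _ _)

theorem toHom_eq_of_sameSurface {n : ℕ} {X Y : Diagram n} {p q : Movie X Y}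
    (h : Movie.SameSurface p q) : toHom (Formal.ofMovie p) = toHom (Formal.ofMovie q) :=
  toHom_eq_iff.mpr (Null.surface p q h)

theorem top_bottom (a b c : ℤ) (h : b = a + 2) (h' : c = b + 2) :
    ofMove (topDotMove a b h) ≫ ofMove (bottomDotMove b c h') =
      ofMove (bottomDotMove a b h) ≫ ofMove (topDotMove b c h') := by
  rw [ofMove_comp_ofMove, ofMove_comp_ofMove]
  apply toHom_eq_of_sameSurface
  have l1 := lab_topDot (lab_nil a) h
  have l2 := lab_bottomDot (lab_nil a) h
  refine (lab_bottomDot l1 h').sameSurface (lab_topDot l2 h') (turnback_first _) (turnback_first _) ?_ ?_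
  · intro k
    rw [l1.weight_snoc _ _ _ _ _ (site_bottomDot _ _ _), l2.weight_snoc _ _ _ _ _ (site_topDot _ _ _),
      (lab_nil a).weight_snoc _ _ _ _ _ (site_bottomDot _ _ _),
      (lab_nil a).weight_snoc _ _ _ _ _ (site_topDot _ _ _)]
    simp [topDotMove, bottomDotMove, LocalMove.euler]
  · intro k
    rw [l1.weight_snoc _ _ _ _ _ (site_bottomDot _ _ _), l2.weight_snoc _ _ _ _ _ (site_topDot _ _ _),
      (lab_nil a).weight_snoc _ _ _ _ _ (site_bottomDot _ _ _),
      (lab_nil a).weight_snoc _ _ _ _ _ (site_topDot _ _ _)]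
    cases k <;> simp [topDotMove, bottomDotMove, LocalMove.dots, upper, v00, v20, Movie.weight]

theorem splitTop_death (a b : ℤ) (h : b = a + 1) :
    ofMove (splitTopMove a b h) ≫ ofMove (circleDeathMove b a h) = 𝟙 (turnback a) := by
  rw [ofMove_comp_ofMove]
  apply toHom_eq_of_sameSurface (q := Movie.nil)
  have l1 := lab_splitTop (lab_nil a) h
  refine (lab_death l1 h rfl rfl rfl rfl).sameSurface (lab_nil a)
    (turnback_first _) (turnback_first _) ?_ ?_
  all_goals
    intro k
    rw [l1.weight_snoc _ _ _ _ _ (site_circleDeath _ _ _),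
      (lab_nil a).weight_snoc _ _ _ _ _ (site_splitTop _ _ _)]
    cases k <;> simp [splitTopMove, circleDeathMove, LocalMove.euler, LocalMove.dots, upper, upperTwo,
      v00, w20, Movie.weight]

theorem splitBottom_death (a b : ℤ) (h : b = a + 1) :
    ofMove (splitBottomMove a b h) ≫ ofMove (circleDeathMove b a h) = 𝟙 (turnback a) := by
  rw [ofMove_comp_ofMove]
  apply toHom_eq_of_sameSurface (q := Movie.nil)
  have l1 := lab_splitBottom (lab_nil a) h
  refine (lab_death l1 h rfl rfl rfl rfl).sameSurface (lab_nil a)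
    (turnback_first _) (turnback_first _) ?_ ?_
  all_goals
    intro k
    rw [l1.weight_snoc _ _ _ _ _ (site_circleDeath _ _ _),
      (lab_nil a).weight_snoc _ _ _ _ _ (site_splitBottom _ _ _)]
    cases k <;> simp [splitBottomMove, circleDeathMove, LocalMove.euler, LocalMove.dots, upper,
      v20, w20, Movie.weight]

theorem splitTop_circleDot (a b c d : ℤ) (h : b = a + 1) (h' : c = b + 2) (h1 : d = a + 2)
    (h1' : c = d + 1) :
    ofMove (splitTopMove a b h) ≫ ofMove (circleDotMove b c h') =
      ofMove (topDotMove a d h1) ≫ ofMove (splitTopMove d c h1') := by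
  rw [ofMove_comp_ofMove, ofMove_comp_ofMove]
  apply toHom_eq_of_sameSurface
  have l1 := lab_splitTop (lab_nil a) h
  have l2 := lab_topDot (lab_nil a) h1
  refine (lab_circleDot l1 h' rfl rfl rfl).sameSurface (lab_splitTop l2 h1')
    (turnback_first _) (turnback_first _) ?_ ?_
  all_goals
    intro k
    rw [l1.weight_snoc _ _ _ _ _ (site_circleDot _ _ _),
      l2.weight_snoc _ _ _ _ _ (site_splitTop _ _ _),
      (lab_nil a).weight_snoc _ _ _ _ _ (site_splitTop _ _ _),
      (lab_nil a).weight_snoc _ _ _ _ _ (site_topDot _ _ _)]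
    cases k <;> simp [splitTopMove, circleDotMove, topDotMove, LocalMove.euler, LocalMove.dots, upper,
      upperTwo, v00, w20, Movie.weight]

theorem splitBottom_circleDot (a b c d : ℤ) (h : b = a + 1) (h' : c = b + 2) (h1 : d = a + 2)
    (h1' : c = d + 1) :
    ofMove (splitBottomMove a b h) ≫ ofMove (circleDotMove b c h') =
      ofMove (bottomDotMove a d h1) ≫ ofMove (splitBottomMove d c h1') := by
  rw [ofMove_comp_ofMove, ofMove_comp_ofMove]
  apply toHom_eq_of_sameSurface
  have l1 := lab_splitBottom (lab_nil a) h
  have l2 := lab_bottomDot (lab_nil a) h1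
  refine (lab_circleDot l1 h' rfl rfl rfl).sameSurface (lab_splitBottom l2 h1')
    (turnback_first _) (turnback_first _) ?_ ?_
  all_goals
    intro k
    rw [l1.weight_snoc _ _ _ _ _ (site_circleDot _ _ _),
      l2.weight_snoc _ _ _ _ _ (site_splitBottom _ _ _),
      (lab_nil a).weight_snoc _ _ _ _ _ (site_splitBottom _ _ _),
      (lab_nil a).weight_snoc _ _ _ _ _ (site_bottomDot _ _ _)]
    cases k <;> simp [splitBottomMove, circleDotMove, bottomDotMove, LocalMove.euler,
      LocalMove.dots, upper, v20, w20, Movie.weight]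

theorem identityDiagram_vertex {a : ℤ} (x : (identityDiagram a).Vertex) : x.1 = (0, 0) ∨ x.1 = (0, 1) := by
  obtain ⟨⟨t, j⟩, h1, h2⟩ := x
  simp only [identityDiagram, List.length_nil, Nat.le_zero_eq] at h1
  subst h1
  simp only [identityDiagram, strands, List.take_nil, endWidth, Option.getD_some] at h2
  interval_cases j <;> simp

def u00 (a : ℤ) : (identityDiagram a).Vertex := ⟨(0, 0), by simp [identityDiagram], by simp [identityDiagram, strands, endWidth]⟩
def u01 (a : ℤ) : (identityDiagram a).Vertex := ⟨(0, 1), by simp [identityDiagram], by simp [identityDiagram, strands, endWidth]⟩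

/-- The constant labelling. -/
def oneLabel (_ : ℕ × ℕ) : Unit := ()

theorem site_saddle (a b : ℤ) (h : b = a + 1) (s) :
    (saddleMove a b h).IsSite s ↔ s = Sum.inl (u00 a) :=
  ⟨fun ⟨_, hs, hx⟩ => hs.trans (congrArg Sum.inl (Subtype.ext hx)), fun hs => ⟨_, hs, rfl⟩⟩

theorem lab_saddle (a b : ℤ) (h : b = a + 1) :
    Movie.IsLabelling (Movie.nil.snoc (saddleMove a b h)) oneLabel oneLabel (fun _ => ()) := by
  have h0 : Movie.IsLabelling (Movie.nil : Movie (identityDiagram a) (identityDiagram a)) oneLabel oneLabel _ :=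
    Movie.IsLabelling.nil oneLabel fun _ _ _ => rfl
  refine cast ?_ (h0.snoc (saddleMove a b h) oneLabel (fun _ _ _ => rfl) (fun _ _ _ => rfl) fun z => ?_)
  · exact congrArg _ (funext fun _ => rfl)
  rcases turnback_vertex z with hz | hz | hz | hz
  · exact ⟨u00 a, Or.inl ⟨Nat.le_refl 0, hz⟩⟩
  · exact ⟨u01 a, Or.inl ⟨Nat.le_refl 0, hz⟩⟩
  · exact ⟨u00 a, Or.inr ⟨Nat.le_refl 0, by rw [hz]; rfl, by rw [hz]; rfl⟩⟩
  · exact ⟨u01 a, Or.inr ⟨Nat.le_refl 0, by rw [hz]; rfl, by rw [hz]; rfl⟩⟩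

theorem saddle_first (a b : ℤ) (h : b = a + 1) (x x' : (identityDiagram a).Vertex) :
    Movie.toComponent (Movie.nil.snoc (saddleMove a b h)) (Movie.first _ x) =
      Movie.toComponent (Movie.nil.snoc (saddleMove a b h)) (Movie.first _ x') := by
  have e0 : Movie.toComponent (Movie.nil.snoc (saddleMove a b h)) (Sum.inl (u00 a)) =
      Movie.toComponent (Movie.nil.snoc (saddleMove a b h)) (Sum.inr (v00 b)) :=
    Quot.sound ⟨u00 a, rfl, Or.inl ⟨Nat.le_refl 0, rfl⟩⟩
  have e1 : Movie.toComponent (Movie.nil.snoc (saddleMove a b h)) (Sum.inl (u01 a)) =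
      Movie.toComponent (Movie.nil.snoc (saddleMove a b h)) (Sum.inr (v01 b)) :=
    Quot.sound ⟨u01 a, rfl, Or.inl ⟨Nat.le_refl 0, rfl⟩⟩
  have e2 : Movie.toComponent (Movie.nil.snoc (saddleMove a b h)) (Sum.inr (v00 b)) =
      Movie.toComponent (Movie.nil.snoc (saddleMove a b h)) (Sum.inr (v01 b)) :=
    Quot.sound ⟨0, .cup 0, (0, 0), (0, 1), rfl, .cup_turn 0, rfl, rfl⟩
  have e : ∀ x : (identityDiagram a).Vertex, Movie.toComponent (Movie.nil.snoc (saddleMove a b h))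
      (Movie.first _ x) = Movie.toComponent (Movie.nil.snoc (saddleMove a b h))
        (Sum.inr (v00 b)) := by
    intro x
    rcases identityDiagram_vertex x with hx | hx
    · obtain rfl : x = u00 a := Subtype.ext hx
      exact e0
    · obtain rfl : x = u01 a := Subtype.ext hx
      exact e1.trans e2.symm
  rw [e x, e x']

theorem saddle_top (a b c : ℤ) (h : b = a + 1) (h' : c = b + 2) :
    ofMove (saddleMove a b h) ≫ ofMove (topDotMove b c h') =
      ofMove (saddleMove a b h) ≫ ofMove (bottomDotMove b c h') := by
  rw [ofMove_comp_ofMove, ofMove_comp_ofMove]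
  apply toHom_eq_of_sameSurface
  have l1 := lab_saddle a b h
  have t1 : ∀ z : (turnback c).Vertex, ∃ y, (topDotMove b c h').Tracks y z := by
    intro z
    refine ⟨z, ?_⟩
    rcases turnback_vertex z with hz | hz | hz | hz <;>
      simp [Move.Tracks, topDotMove, hz, LocalMove.source, LocalMove.target]
  have t2 : ∀ z : (turnback c).Vertex, ∃ y, (bottomDotMove b c h').Tracks y z := by
    intro z
    refine ⟨z, ?_⟩
    rcases turnback_vertex z with hz | hz | hz | hz <;>
      simp [Move.Tracks, bottomDotMove, hz, LocalMove.source, LocalMove.target]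
  refine (l1.snoc (topDotMove b c h') oneLabel (fun _ _ _ => rfl) (fun _ _ _ => rfl) t1).sameSurface
    (l1.snoc (bottomDotMove b c h') oneLabel (fun _ _ _ => rfl) (fun _ _ _ => rfl) t2)
    (fun x x' _ => Movie.mk_inl _ (saddle_first a b h x x'))
    (fun x x' _ => Movie.mk_inl _ (saddle_first a b h x x')) ?_ ?_
  all_goals
    intro k
    rw [l1.weight_snoc _ _ _ _ _ (site_topDot _ _ _),
      l1.weight_snoc _ _ _ _ _ (site_bottomDot _ _ _)]
    rfl

theorem neck_circle (a c d e f : ℤ) (h1 : c = a + 2) (h2 : c = d + 1) (h3 : d = a + 1)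
    (h4 : a = e + 1) (h5 : e = f + 1) (h6 : a = f + 2) : 𝟙 (turnback₂ a) =
    ofMove (circleDotMove a c h1) ≫ ofMove (circleDeathMove c d h2) ≫
      ofMove (circleBirthMove d a h3) +
    ofMove (circleDeathMove a e h4) ≫ ofMove (circleBirthMove e f h5) ≫
      ofMove (circleDotMove f a h6) := by
  have := toHom_eq_iff.mpr ((sub_sub _ _ _).subst (Null.neck (circleDotMove a c h1)
    (circleDeathMove c d h2) (circleBirthMove d a h3)
    (circleDeathMove a e h4) (circleBirthMove e f h5)
    (circleDotMove f a h6) [.cup 0] 0 ⟨rfl, rfl⟩ ⟨rfl, rfl⟩ ⟨rfl, rfl⟩ ⟨rfl, rfl⟩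
    ⟨rfl, rfl⟩ ⟨rfl, rfl⟩))
  refine this.trans ((map_add _ _ _).trans ?_)
  rw [ofMove_comp_ofMove, ofMove_comp_ofMove, ofMove_comp_toHom, ofMove_comp_toHom]
  rfl

theorem circle_dot_dot (a b c d e : ℤ) (h1 : a = b + 1) (h2 : c = b + 2) (h3 : d = c + 2)
    (h4 : d = e + 1) :
    ofMove (circleBirthMove a b h1) ≫ ofMove (circleDotMove b c h2) ≫
      ofMove (circleDotMove c d h3) ≫ ofMove (circleDeathMove d e h4) = 0 := by
  have := toHom_eq_iff.mpr ((sub_zero (Formal.ofMovie _)).symm.subst (Null.sphere_dot_dot (circleBirthMove a b h1)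
    (circleDotMove b c h2) (circleDotMove c d h3) (circleDeathMove d e h4) [.cup 0] 0 ⟨rfl, rfl⟩
    ⟨rfl, rfl⟩ ⟨rfl, rfl⟩ ⟨rfl, rfl⟩))
  refine Eq.trans ?_ (this.trans (map_zero _))
  rw [ofMove_comp_ofMove, ofMove_comp_toHom, ofMove_comp_toHom]
  rfl

/-- The disjoint union of the identity with a sphere carrying three dots. -/
def alphaMap (a c : ℤ) (h : c = a + 4) : turnback a ⟶ turnback c :=
  ofMove (circleBirthMove a (a - 1) (by ring)) ≫
    ofMove (circleDotMove (a - 1) (a + 1) (by ring)) ≫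
    ofMove (circleDotMove (a + 1) (a + 3) (by ring)) ≫
    ofMove (circleDotMove (a + 3) (a + 5) (by ring)) ≫
    ofMove (circleDeathMove (a + 5) c (by omega))

theorem top_top (a b c : ℤ) (h : b = a + 2) (h' : c = b + 2) :
    ofMove (topDotMove a b h) ≫ ofMove (topDotMove b c h') = alphaMap a c (by omega) := by
  have e1 := splitTop_death c (a + 5) (by omega)
  have e2 := splitTop_circleDot b (a + 3) (a + 5) c (by omega) (by omega) h' (by omega)
  have e3 := splitTop_circleDot a (a + 1) (a + 3) b (by omega) (by omega) h (by omega)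
  have e4 := splitTop_death a (a + 1) rfl
  have e5 := neck_circle (a + 1) (a + 3) (a + 2) a (a - 1) (by ring) (by ring) (by ring) rfl
    (by ring) (by ring)
  have e6 := circle_dot_dot (a + 2) (a + 1) (a + 3) (a + 5) c (by ring) (by ring) (by ring)
    (by omega)
  rw [← Category.comp_id (ofMove (topDotMove b c h')), ← e1, ← reassoc_of% e2, ← reassoc_of% e3,
    ← Category.id_comp (ofMove (circleDotMove (a + 1) (a + 3) _)), e5]
  simp only [Preadditive.add_comp, Category.assoc, e6, Limits.comp_zero,
    zero_add, reassoc_of% e4, alphaMap]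

theorem bottom_bottom (a b c : ℤ) (h : b = a + 2) (h' : c = b + 2) :
    ofMove (bottomDotMove a b h) ≫ ofMove (bottomDotMove b c h') = alphaMap a c (by omega) := by
  have e1 := splitBottom_death c (a + 5) (by omega)
  have e2 := splitBottom_circleDot b (a + 3) (a + 5) c (by omega) (by omega) h' (by omega)
  have e3 := splitBottom_circleDot a (a + 1) (a + 3) b (by omega) (by omega) h (by omega)
  have e4 := splitBottom_death a (a + 1) rfl
  have e5 := neck_circle (a + 1) (a + 3) (a + 2) a (a - 1) (by ring) (by ring) (by ring) rfl
    (by ring) (by ring)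
  have e6 := circle_dot_dot (a + 2) (a + 1) (a + 3) (a + 5) c (by ring) (by ring) (by ring)
    (by omega)
  rw [← Category.comp_id (ofMove (bottomDotMove b c h')), ← e1, ← reassoc_of% e2, ← reassoc_of% e3,
    ← Category.id_comp (ofMove (circleDotMove (a + 1) (a + 3) _)), e5]
  simp only [Preadditive.add_comp, Category.assoc, e6, Limits.comp_zero,
    zero_add, reassoc_of% e4, alphaMap]


namespace SecondProjector

/-- The diagrams of the second projector: `q ^ 0` times the identity diagram in homological degree `0`
and `q ^ (2 m - 1)` times the turnback in homological degree `m > 0`. -/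
def X : ℕ → Cob 2
  | 0 => identityDiagram 0
  | k + 1 => turnback (2 * (k + 1 : ℕ) - 1)

/-- The saddle in homological degree `0`. -/
def saddle : X 0 ⟶ X 1 :=
  ofMove (saddleMove 0 (2 * (0 + 1 : ℕ) - 1) (by norm_num))

/-- The dot on the upper sheet, in homological degree `k + 1`. -/
def topDot (k : ℕ) : X (k + 1) ⟶ X (k + 1 + 1) :=
  ofMove (topDotMove (2 * (k + 1 : ℕ) - 1) (2 * (k + 1 + 1 : ℕ) - 1) (by push_cast; ring))

/-- The dot on the lower sheet, in homological degree `k + 1`. -/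
def bottomDot (k : ℕ) : X (k + 1) ⟶ X (k + 1 + 1) :=
  ofMove (bottomDotMove (2 * (k + 1 : ℕ) - 1) (2 * (k + 1 + 1 : ℕ) - 1) (by push_cast; ring))

/-- The differential: the saddle in degree `0`, the sum of the two dots in even degrees `m ≠ 0` and
the top dot minus the bottom dot in odd degrees. -/
def d : ∀ k : ℕ, X k ⟶ X (k + 1)
  | 0 => saddle
  | k + 1 => if Even (k + 1) then topDot k + bottomDot k else topDot k - bottomDot k

theorem add_comp_sub {A B C : Cob 2} (t b : A ⟶ B) (t' b' : B ⟶ C)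
    (h : t ≫ t' = b ≫ b') (h' : t ≫ b' = b ≫ t') :
    (t + b) ≫ (t' - b') = 0 ∧ (t - b) ≫ (t' + b') = 0 := by
  simp only [Preadditive.comp_sub, Preadditive.add_comp, Preadditive.comp_add,
    Preadditive.sub_comp, h, h']
  constructor <;> abel

theorem d_succ (k : ℕ) :
    d (k + 1) = if Even (k + 1) then topDot k + bottomDot k else topDot k - bottomDot k := rfl

theorem d_comp_d (k : ℕ) : d k ≫ d (k + 1) = 0 := by
  match k with
  | 0 =>
    have h : saddle ≫ topDot 0 = saddle ≫ bottomDot 0 := saddle_top _ _ _ _ _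
    have h0 : ¬ Even (0 + 1) := by decide
    have d1 : d (0 + 1) = topDot 0 - bottomDot 0 :=
      (d_succ 0).trans (if_neg h0)
    rw [d1]
    exact (Preadditive.comp_sub _ _ _).trans (sub_eq_zero.mpr h)
  | k + 1 =>
    have h := add_comp_sub (topDot k) (bottomDot k) (topDot (k + 1)) (bottomDot (k + 1))
      ((top_top _ _ _ _ _).trans (bottom_bottom _ _ _ _ _).symm) (top_bottom _ _ _ _ _)
    by_cases hk : Even (k + 1)
    · have hk' : ¬ Even (k + 1 + 1) := by rw [Nat.even_add_one]; simpa using hk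
      have d1 : d (k + 1) = topDot k + bottomDot k := if_pos hk
      have d2 : d (k + 1 + 1) = topDot (k + 1) - bottomDot (k + 1) := if_neg hk'
      rw [d1, d2]
      exact h.1
    · have hk' : Even (k + 1 + 1) := by rw [Nat.even_add_one]; exact hk
      have d1 : d (k + 1) = topDot k - bottomDot k := if_neg hk
      have d2 : d (k + 1 + 1) = topDot (k + 1) + bottomDot (k + 1) := if_pos hk'
      rw [d1, d2]
      exact h.2

end SecondProjector

/-- The second projector. -/
noncomputable def P₂ : Kom 2 :=
  CochainComplex.of (fun k => (Mat_.embedding (Cob 2)).obj (SecondProjector.X k))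
    (fun k => (Mat_.embedding (Cob 2)).map (SecondProjector.d k))
    (fun k => by rw [← Functor.map_comp, SecondProjector.d_comp_d, Functor.map_zero])

/-- The turnback `e₁`, as a complex in homological degree `0` and `q`-degree `0`. -/
noncomputable def e₁ : Kom 2 := Kom.single (turnback 0)

end BarNatan

open scoped ZeroObject

/-!
The second projector has the identity diagram in degree `0` and turnbacks `e` elsewhere, and everything
follows from the contraction of `P₂ ⊗ e`. Its terms in positive degree are `e` with a circle between the
arcs, and neck cutting at that circle reads `1 = C R + R C`, where `C` is the dot on the circle and `R`
(`recap`) caps the circle off and creates it anew. The differentials are `O ± C` with `O` the dot on the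
outer arc, which commutes with `R`; as the signs alternate, `± R` is a contraction in degrees above `1`.
In the lowest degrees the saddle `e → e ∘ e` splits a circle off, is undone by the death of the circle, and
neck cutting expresses it through births and dots (`splitTop_eq`), so that the death completes the
contraction (`d_zero_rightContraction`, `d_succ_rightContraction`). The mirror image contracts `e ⊗ P₂`.
That `O` commutes with the death is the equality of two surfaces (`topDot₂_death`); for the birth, which
makes a component that does not meet the first frame, it is deduced from neck cutting by means of
`hom_ext_turnback₂`.

For `P₂ ⊗ P₂` consider the projection onto the column `P₂ ⊗ 1 = P₂`. It is degreewise split, and its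
kernel is the total complex of a double complex all of whose columns are of the form `P₂ ⊗ e`, hence
contractible. The contractions of the columns do not commute with the dots of the second factor, but they
combine to a null-homotopic endomorphism of the total complex that differs from the identity by a
nilpotent map in each degree; it is therefore an automorphism, and the total complex is contractible
(`HomologicalComplex.nonempty_homotopy_mapBifunctor_id_zero`). Dividing out a contractible, degreewise
split subcomplex is a homotopy equivalence (`HomotopyEquiv.ofSplitContractible`).
-/

/-! ### Contractible complexes -/

section Contractible

variable {V : Type*} [Category* V] [Preadditive V] {ι : Type*} {c : ComplexShape ι}

/-- A complex is contractible as soon as some automorphism of it is null-homotopic. -/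
noncomputable def Homotopy.idOfIsIso {K : HomologicalComplex V c} (φ : K ⟶ K) [IsIso φ] (h : Homotopy φ 0) :
    Homotopy (𝟙 K) 0 :=
  (Homotopy.ofEq (IsIso.hom_inv_id φ).symm).trans
    ((h.compRight (inv φ)).trans (Homotopy.ofEq Limits.zero_comp))

/-- A complex whose identity is null-homotopic is homotopy equivalent to the zero complex. -/
noncomputable def Homotopy.equivZero [Limits.HasZeroObject V] {K : HomologicalComplex V c}
    (h : Homotopy (𝟙 K) 0) : HomotopyEquiv K 0 where
  hom := 0
  inv := 0
  homotopyHomInvId := (Homotopy.ofEq Limits.zero_comp).trans h.symm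
  homotopyInvHomId := Homotopy.ofEq ((Limits.isZero_zero _).eq_of_src _ _)

/-- In a degreewise split short exact sequence `K → A → B` with contractible `K`, the projection `A → B`
is a homotopy equivalence. The homotopy inverse corrects the degreewise section `s` by the contraction of
`K` applied to the failure of `s` to commute with the differentials. -/
noncomputable def HomotopyEquiv.ofSplitContractible {K A B : HomologicalComplex V c} (i : K ⟶ A) (p : A ⟶ B)
    (r : ∀ k, A.X k ⟶ K.X k) (s : ∀ k, B.X k ⟶ A.X k)
    (ir : ∀ k, i.f k ≫ r k = 𝟙 _) (sp : ∀ k, s k ≫ p.f k = 𝟙 _)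
    (ri : ∀ k, r k ≫ i.f k + p.f k ≫ s k = 𝟙 _) (h : Homotopy (𝟙 K) 0) : HomotopyEquiv A B :=
  have ip : ∀ k, i.f k ≫ p.f k = 0 := fun k => by
    have := congrArg (fun f => i.f k ≫ f ≫ p.f k) (ri k)
    simpa [sp, reassoc_of% (ir k)] using this
  have sr : ∀ k, s k ≫ r k = 0 := fun k => by
    have := congrArg (fun f => s k ≫ f ≫ r k) (ri k)
    simpa [ir, reassoc_of% (sp k)] using this
  have psd : ∀ k l, A.d k l ≫ r l = r k ≫ K.d k l + p.f k ≫ s k ≫ A.d k l ≫ r l := fun k l => by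
    have := congrArg (fun f => f ≫ A.d k l ≫ r l) (ri k)
    simpa [ir] using this.symm
  have sdr : ∀ k l l', s k ≫ A.d k l ≫ r l ≫ K.d l l' = -(B.d k l ≫ s l ≫ A.d l l' ≫ r l') :=
      fun k l l' => by
    have := congrArg (fun f => s k ≫ A.d k l ≫ f ≫ A.d l l' ≫ r l') (ri l)
    simp only [Preadditive.add_comp, Preadditive.comp_add, Category.assoc, Category.id_comp,
      i.comm_assoc, ir, Category.comp_id, A.d_comp_d_assoc, Limits.zero_comp, Limits.comp_zero,
      ← p.comm_assoc, reassoc_of% (sp k)] at this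
    exact eq_neg_of_add_eq_zero_left this
  let g : B ⟶ A :=
    { f k := s k - s k ≫ A.d k (c.next k) ≫ r _ ≫ h.hom (c.next k) k ≫ i.f k
      comm' k l hkl := by
        obtain rfl := c.next_eq' hkl
        set l := c.next k
        have hc : K.d l (c.next l) ≫ h.hom (c.next l) l + h.hom l k ≫ K.d k l = 𝟙 _ := by
          have := h.comm l
          rw [prevD_eq _ hkl] at this
          simpa [dNext] using this.symm
        have e := congrArg (fun f => s k ≫ A.d k l ≫ r l ≫ f ≫ i.f l) hc
        have e' := congrArg (fun f => s k ≫ A.d k l ≫ f) (ri l)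
        simp only [Preadditive.add_comp, Preadditive.comp_add, Category.assoc, Category.id_comp,
          reassoc_of% (sdr k l (c.next l)), Preadditive.neg_comp, Category.comp_id,
          ← p.comm_assoc, reassoc_of% (sp k)] at e e'
        simp only [Preadditive.sub_comp, Preadditive.comp_sub, Category.assoc, i.comm]
        rw [← e', ← e]
        abel }
  { hom := p
    inv := g
    homotopyHomInvId :=
      { hom k l := -(r k ≫ h.hom k l ≫ i.f l)
        zero k l hkl := by simp [h.zero k l hkl]
        comm k := by
          have hc : K.d k (c.next k) ≫ h.hom (c.next k) k + h.hom k (c.prev k) ≫ K.d (c.prev k) k =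
              𝟙 _ := by
            simpa [dNext, prevD] using (h.comm k).symm
          have e := congrArg (fun f => r k ≫ f ≫ i.f k) hc
          have e' := ri k
          simp only [Preadditive.add_comp, Preadditive.comp_add, Category.assoc, Category.id_comp]
            at e
          simp only [dNext, prevD, AddMonoidHom.mk'_apply, HomologicalComplex.comp_f,
            HomologicalComplex.id_f, g, Preadditive.comp_sub,
            Preadditive.comp_neg, Preadditive.neg_comp, Category.assoc, i.comm]
          rw [reassoc_of% (psd k (c.next k)), Preadditive.add_comp, ← e', ← e]
          simp only [Category.assoc, Preadditive.comp_add, reassoc_of% sr, reassoc_of% sp,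
            Limits.zero_comp, zero_add]
          abel }
    homotopyInvHomId := Homotopy.ofEq (by
      ext k
      simp [g, sp, ip]) }

end Contractible

namespace HomologicalComplex

open ComplexShape

/-! ### Double complexes with contractible columns -/

section Columns

variable {C₁ C₂ D : Type*} [Category* C₁] [Category* C₂] [Category* D]
  [Limits.HasZeroMorphisms C₁] [Limits.HasZeroMorphisms C₂] [Preadditive D]
  {K : CochainComplex C₁ ℕ} {L : CochainComplex C₂ ℕ}
  {F : C₁ ⥤ C₂ ⥤ D} [F.PreservesZeroMorphisms] [∀ X, (F.obj X).PreservesZeroMorphisms]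
  [HasMapBifunctor K L F (up ℕ)]

/-- A family of maps that lower the first index of the double complex `F (K i) (L j)`, as a family of
maps of degree `-1` on the total complex. -/
noncomputable def columnHomotopy
    (h : ∀ i j, (F.obj (K.X (i + 1))).obj (L.X j) ⟶ (F.obj (K.X i)).obj (L.X j))
    (k' k : ℕ) (e : k + 1 = k') :
    (mapBifunctor K L F (up ℕ)).X k' ⟶ (mapBifunctor K L F (up ℕ)).X k :=
  mapBifunctorDesc fun i j hij => match i, hij with
    | 0, _ => 0
    | i + 1, hij => h i j ≫ ιMapBifunctor K L F (up ℕ) i j k (by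
        change i + 1 + j = k' at hij
        change i + j = k
        omega)

theorem ι_zero_columnHomotopy
    (h : ∀ i j, (F.obj (K.X (i + 1))).obj (L.X j) ⟶ (F.obj (K.X i)).obj (L.X j))
    (k' k : ℕ) (e : k + 1 = k') (j : ℕ) (hj) :
    ιMapBifunctor K L F (up ℕ) 0 j k' hj ≫ columnHomotopy h k' k e = 0 :=
  ι_mapBifunctorDesc _ _ _ _

theorem ι_succ_columnHomotopy
    (h : ∀ i j, (F.obj (K.X (i + 1))).obj (L.X j) ⟶ (F.obj (K.X i)).obj (L.X j))
    (k' k : ℕ) (e : k + 1 = k') (i j : ℕ) (hj) (hj') :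
    ιMapBifunctor K L F (up ℕ) (i + 1) j k' hj ≫ columnHomotopy h k' k e =
      h i j ≫ ιMapBifunctor K L F (up ℕ) i j k hj' :=
  ι_mapBifunctorDesc _ _ _ _

/-- The differential of the total complex on one summand, with the signs `1` and `(-1) ^ i`. -/
theorem ι_total_d (i j k k' : ℕ) (hk : i + j = k) (hk' : k + 1 = k') :
    ιMapBifunctor K L F (up ℕ) i j k hk ≫ (mapBifunctor K L F (up ℕ)).d k k' =
      (F.map (K.d i (i + 1))).app (L.X j) ≫ ιMapBifunctor K L F (up ℕ) (i + 1) j k'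
        (by change i + 1 + j = k'; omega) +
      ((-1 : ℤˣ) ^ i) • ((F.obj (K.X i)).map (L.d j (j + 1)) ≫
        ιMapBifunctor K L F (up ℕ) i (j + 1) k' (by change i + (j + 1) = k'; omega)) := by
  rw [mapBifunctor.d_eq, Preadditive.comp_add]
  congr 1
  · rw [mapBifunctor.ι_D₁]
    rw [mapBifunctor.d₁_eq K L F (up ℕ) (show (up ℕ).Rel i (i+1) from rfl) j k'
      (by change i + 1 + j = k'; omega)]
    exact one_smul _ _
  · rw [mapBifunctor.ι_D₂]
    rw [mapBifunctor.d₂_eq K L F (up ℕ) i (show (up ℕ).Rel j (j+1) from rfl) k'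
      (by change i + (j + 1) = k'; omega)]
    rfl

/-- If every column `F (K ⬝) (L j)` of the double complex is contractible, then so is the total complex. -/
theorem nonempty_homotopy_mapBifunctor_id_zero
    (h : ∀ i j, (F.obj (K.X (i + 1))).obj (L.X j) ⟶ (F.obj (K.X i)).obj (L.X j))
    (h_zero : ∀ j, (F.map (K.d 0 1)).app (L.X j) ≫ h 0 j = 𝟙 _)
    (h_succ : ∀ i j, (F.map (K.d (i + 1) (i + 1 + 1))).app (L.X j) ≫ h (i + 1) j +
      h i j ≫ (F.map (K.d i (i + 1))).app (L.X j) = 𝟙 _) :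
    Nonempty (Homotopy (𝟙 (mapBifunctor K L F (up ℕ))) 0) := by
  let T := mapBifunctor K L F (up ℕ)
  let φ : T ⟶ T := Homotopy.nullHomotopicMap' (columnHomotopy h)
  -- `N` lowers the first index by one, as the differential of `L` need not respect `h`; that makes it
  -- nilpotent in each degree.
  let N : ∀ k, End (T.X k) := fun k => φ.f k - 𝟙 _
  have hφ0 : φ.f 0 = T.d 0 1 ≫ columnHomotopy h 1 0 rfl :=
    Homotopy.nullHomotopicMap'_f_of_not_rel_right (c := up ℕ) (k₁ := 0) (k₀ := 1) rfl
      (fun l hl => by simp at hl) _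
  have hφs : ∀ k, φ.f (k + 1) = T.d (k + 1) (k + 1 + 1) ≫ columnHomotopy h (k + 1 + 1) (k + 1) rfl +
      columnHomotopy h (k + 1) k rfl ≫ T.d k (k + 1) := fun k =>
    Homotopy.nullHomotopicMap'_f (c := up ℕ) (k₀ := k + 1 + 1) (k₁ := k + 1) (k₂ := k) rfl rfl _
  have hN0 : ∀ k j (hj : 0 + j = k), ιMapBifunctor K L F (up ℕ) 0 j k hj ≫ N k = 0 := by
    intro k j hj
    have key : ∀ hj' , ιMapBifunctor K L F (up ℕ) 0 j k hj ≫ T.d k (k + 1) ≫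
        columnHomotopy h (k + 1) k rfl = ιMapBifunctor K L F (up ℕ) 0 j k hj' := by
      intro hj'
      rw [reassoc_of% (ι_total_d (K := K) (L := L) (F := F) 0 j k (k + 1) hj rfl)]
      rw [Preadditive.add_comp, Category.assoc, ι_succ_columnHomotopy h _ _ _ _ _ _ hj,
        reassoc_of% (h_zero j), Linear.units_smul_comp, Category.assoc, ι_zero_columnHomotopy,
        Limits.comp_zero, smul_zero, add_zero]
    rw [Preadditive.comp_sub, Category.comp_id, sub_eq_zero]
    cases k with
    | zero => rw [hφ0]; exact key _
    | succ k =>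
      rw [hφs, Preadditive.comp_add, reassoc_of% (ι_zero_columnHomotopy h), Limits.zero_comp,
        add_zero]
      exact key _
  have hNs : ∀ k i j (hj : i + 1 + j = k), ∃ ν, ιMapBifunctor K L F (up ℕ) (i + 1) j k hj ≫ N k =
      ν ≫ ιMapBifunctor K L F (up ℕ) i (j + 1) k (by change i + (j + 1) = k; omega) := by
    intro k i j hj
    obtain ⟨k, rfl⟩ : ∃ l, k = l + 1 := ⟨i + j, by omega⟩
    refine ⟨(-1 : ℤˣ) ^ (i + 1) • ((F.obj (K.X (i + 1))).map (L.d j (j + 1)) ≫ h i (j + 1)) +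
      (-1 : ℤˣ) ^ i • (h i j ≫ (F.obj (K.X i)).map (L.d j (j + 1))), ?_⟩
    rw [Preadditive.comp_sub, Category.comp_id, hφs, Preadditive.comp_add,
      reassoc_of% (ι_total_d (K := K) (L := L) (F := F) (i + 1) j (k + 1) (k + 1 + 1) hj rfl),
      reassoc_of% (ι_succ_columnHomotopy h (k + 1) k rfl i j hj (by change i + j = k; omega)),
      ι_total_d i j k (k + 1) (by omega) rfl,
      Preadditive.add_comp, Category.assoc, ι_succ_columnHomotopy h _ _ _ _ _ _ hj,
      Linear.units_smul_comp, Category.assoc,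
      ι_succ_columnHomotopy h _ _ _ _ _ _ (by change i + (j + 1) = k + 1; omega),
      Preadditive.comp_add, Preadditive.add_comp, Linear.units_smul_comp, Linear.units_smul_comp,
      Linear.comp_units_smul, sub_eq_iff_eq_add]
    have hid := (Category.id_comp (ιMapBifunctor K L F (up ℕ) (i + 1) j (k + 1) hj)).symm
    rw [← h_succ i j, Preadditive.add_comp] at hid
    simp only [Category.assoc] at hid ⊢
    rw [eq_sub_of_add_eq hid.symm]
    abel
  have hpow : ∀ k i j (hj : i + j = k), ιMapBifunctor K L F (up ℕ) i j k hj ≫ (N k ^ (i + 1) : End _) = 0 := by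
    intro k i
    induction i with
    | zero => intro j hj; rw [zero_add, pow_one]; exact hN0 k j hj
    | succ i ih =>
      intro j hj
      obtain ⟨ν, hν⟩ := hNs k i j hj
      rw [pow_succ, End.mul_def, reassoc_of% hν, ih, Limits.comp_zero]
  have hnil : ∀ k, IsNilpotent (N k) := fun k => ⟨k + 1, by
    apply mapBifunctor.hom_ext
    intro i j hij
    have hij : i + j = k := hij
    have e : k + 1 = j + (i + 1) := by omega
    rw [e, pow_add, End.mul_def, reassoc_of% (hpow k i j hij)]
    simp⟩
  have : ∀ k, IsIso (φ.f k) := fun k => by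
    have := (hnil k).isUnit_one_add
    rw [isUnit_iff_isIso] at this
    convert this
    exact (add_sub_cancel _ _).symm
  have : IsIso φ := Hom.isIso_of_components φ
  exact ⟨Homotopy.idOfIsIso φ (Homotopy.nullHomotopy' _)⟩

end Columns

/-! ### The projection onto the first column -/

section Positive

variable {C : Type*} [Category* C] [Limits.HasZeroMorphisms C] [Limits.HasZeroObject C]

/-- The subcomplex of a cochain complex that consists of its terms of positive degree. -/
noncomputable def positivePart (L : CochainComplex C ℕ) : CochainComplex C ℕ where
  X k := match k with
    | 0 => 0
    | k + 1 => L.X (k + 1)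
  d i j := match i, j with
    | i + 1, j + 1 => L.d (i + 1) (j + 1)
    | 0, _ => 0
    | _ + 1, 0 => 0
  shape i j hij := match i, j with
    | _ + 1, _ + 1 => L.shape _ _ hij
    | 0, _ => rfl
    | _ + 1, 0 => rfl
  d_comp_d' i j k _ _ := match i, j, k with
    | _ + 1, _ + 1, _ + 1 => L.d_comp_d _ _ _
    | _ + 1, _ + 1, 0 => Limits.comp_zero
    | _ + 1, 0, _ => Limits.zero_comp
    | 0, _, _ => Limits.zero_comp

variable (L : CochainComplex C ℕ)

/-- The inclusion of the terms of positive degree. -/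
noncomputable def positivePartι : L.positivePart ⟶ L where
  f k := match k with
    | 0 => 0
    | k + 1 => 𝟙 (L.X (k + 1))
  comm' i j hij := match i, j with
    | i + 1, j + 1 => (Category.id_comp _).trans (Category.comp_id (L.d (i + 1) (j + 1))).symm
    | 0, _ => Limits.zero_comp.trans Limits.zero_comp.symm
    | _ + 1, 0 => (Nat.succ_ne_zero _ hij).elim

/-- The degreewise retraction of the inclusion of the terms of positive degree. -/
noncomputable def positivePartRetraction (k : ℕ) : L.X k ⟶ L.positivePart.X k :=
  match k with
  | 0 => 0
  | k + 1 => 𝟙 (L.X (k + 1))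

theorem positivePartι_retraction (k : ℕ) :
    L.positivePartι.f k ≫ L.positivePartRetraction k = 𝟙 _ :=
  match k with
  | 0 => (Limits.isZero_zero C).eq_of_src _ _
  | _ + 1 => Category.id_comp _

theorem positivePartRetraction_succ_ι (k : ℕ) :
    L.positivePartRetraction (k + 1) ≫ L.positivePartι.f (k + 1) = 𝟙 _ :=
  Category.id_comp _

end Positive

section FirstColumn

variable {C₁ C₂ D : Type*} [Category* C₁] [Category* C₂] [Category* D]
  [Limits.HasZeroMorphisms C₁] [Limits.HasZeroMorphisms C₂] [Limits.HasZeroObject C₂] [Preadditive D]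
  {K : CochainComplex C₁ ℕ} {L : CochainComplex C₂ ℕ}
  {F : C₁ ⥤ C₂ ⥤ D} [F.PreservesZeroMorphisms] [∀ X, (F.obj X).PreservesZeroMorphisms]
  [HasMapBifunctor K L F (up ℕ)] [HasMapBifunctor K L.positivePart F (up ℕ)]
  {B : CochainComplex D ℕ}

/-- The projection of the total complex of the double complex `F (K i) (L j)` onto its column `j = 0`. -/
noncomputable def toFirstColumn (α : ∀ k, (F.obj (K.X k)).obj (L.X 0) ≅ B.X k)
    (hα : ∀ k, (F.map (K.d k (k + 1))).app (L.X 0) ≫ (α (k + 1)).hom = (α k).hom ≫ B.d k (k + 1)) :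
    mapBifunctor K L F (up ℕ) ⟶ B where
  f k := mapBifunctorDesc fun i j hij => match j, hij with
    | 0, hij => (α i).hom ≫ (B.XIsoOfEq hij).hom
    | _ + 1, _ => 0
  comm' k k' hk := by
    obtain rfl : k + 1 = k' := hk
    apply mapBifunctor.hom_ext
    intro i j hij
    rw [ι_mapBifunctorDesc_assoc, reassoc_of% (ι_total_d i j k (k + 1) hij rfl)]
    rw [Preadditive.add_comp, Category.assoc, ι_mapBifunctorDesc, Linear.units_smul_comp,
      Category.assoc, ι_mapBifunctorDesc]
    match j, hij with
    | 0, hij =>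
      obtain rfl : i = k := hij
      simp [hα]
    | j + 1, hij => simp

/-- If all columns `F (K ⬝) (L j)` with `j > 0` are contractible, then the total complex is homotopy
equivalent to its column `j = 0`. -/
theorem nonempty_homotopyEquiv_firstColumn (α : ∀ k, (F.obj (K.X k)).obj (L.X 0) ≅ B.X k)
    (hα : ∀ k, (F.map (K.d k (k + 1))).app (L.X 0) ≫ (α (k + 1)).hom = (α k).hom ≫ B.d k (k + 1))
    (h : ∀ i j, (F.obj (K.X (i + 1))).obj (L.X (j + 1)) ⟶ (F.obj (K.X i)).obj (L.X (j + 1)))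
    (h_zero : ∀ j, (F.map (K.d 0 1)).app (L.X (j + 1)) ≫ h 0 j = 𝟙 _)
    (h_succ : ∀ i j, (F.map (K.d (i + 1) (i + 1 + 1))).app (L.X (j + 1)) ≫ h (i + 1) j +
      h i j ≫ (F.map (K.d i (i + 1))).app (L.X (j + 1)) = 𝟙 _) :
    Nonempty (HomotopyEquiv (mapBifunctor K L F (up ℕ)) B) := by
  have hz : ∀ i, Limits.IsZero ((F.obj (K.X i)).obj (L.positivePart.X 0)) := fun i =>
    (F.obj (K.X i)).map_isZero (Limits.isZero_zero C₂)
  obtain ⟨H⟩ : Nonempty (Homotopy (𝟙 (mapBifunctor K L.positivePart F (up ℕ))) 0) :=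
    nonempty_homotopy_mapBifunctor_id_zero
      (fun i j => match j with
        | 0 => 0
        | j + 1 => h i j)
      (fun j => match j with
        | 0 => (hz 0).eq_of_src _ _
        | j + 1 => h_zero j)
      (fun i j => match j with
        | 0 => (hz (i + 1)).eq_of_src _ _
        | j + 1 => h_succ i j)
  refine ⟨HomotopyEquiv.ofSplitContractible
    (mapBifunctorMap (𝟙 K) L.positivePartι F (up ℕ)) (toFirstColumn α hα)
    (fun k => mapBifunctorDesc fun i j hij => (F.obj (K.X i)).map (L.positivePartRetraction j) ≫
      ιMapBifunctor K L.positivePart F (up ℕ) i j k hij)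
    (fun k => (α k).inv ≫ ιMapBifunctor K L F (up ℕ) k 0 k (add_zero k)) ?_ ?_ ?_ H⟩
  · intro k
    apply mapBifunctor.hom_ext
    intro i j hij
    rw [ι_mapBifunctorMap_assoc, ι_mapBifunctorDesc, ← Functor.map_comp_assoc,
      positivePartι_retraction]
    simp
  · intro k
    rw [Category.assoc, toFirstColumn, ι_mapBifunctorDesc]
    simp
  · intro k
    apply mapBifunctor.hom_ext
    intro i j hij
    rw [Preadditive.comp_add, ι_mapBifunctorDesc_assoc, toFirstColumn, ι_mapBifunctorDesc_assoc,
      Category.assoc, ι_mapBifunctorMap]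
    match j, hij with
    | 0, hij =>
      obtain rfl : i = k := hij
      simp [positivePartRetraction]
    | j + 1, hij =>
      rw [id_f, CategoryTheory.Functor.map_id, NatTrans.id_app, Category.id_comp,
        ← Functor.map_comp_assoc,
        positivePartRetraction_succ_ι]
      simp

end FirstColumn

/-- The sign `(-1) ^ (p * q)` of the symmetry that exchanges the two indices of a double complex. -/
instance : TotalComplexShapeSymmetry (up ℕ) (up ℕ) (up ℕ) where
  symm p q := add_comm q p
  σ p q := (-1) ^ (p * q)
  σ_ε₁ := by
    rintro p _ rfl q
    change (-1 : ℤˣ) ^ (p * q) * 1 = (-1) ^ q * (-1) ^ ((p + 1) * q)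
    rw [mul_one, ← pow_add, show q + (p + 1) * q = p * q + 2 * q by ring, pow_add, pow_mul (-1) 2]
    simp
  σ_ε₂ := by
    rintro p q _ rfl
    change (-1 : ℤˣ) ^ (p * q) * (-1) ^ p = 1 * (-1) ^ (p * (q + 1))
    rw [one_mul, ← pow_add, mul_add, mul_one]

end HomologicalComplex

namespace BarNatan

open Diagram

/-! ### Outer dots on two glued turnbacks -/

theorem Diagram.whiskerLeft_ofMove {n : ℕ} (D : Diagram n) {X Y : Diagram n} (m : Move X Y) :
    whiskerLeft D (ofMove m) = ofMove (m.glueLeft D) :=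
  congrArg toHom (Formal.glueLeft_of D _)

theorem Diagram.whiskerRight_ofMove {n : ℕ} (D : Diagram n) {X Y : Diagram n} (m : Move X Y) :
    whiskerRight D (ofMove m) = ofMove (m.glueRight D) :=
  congrArg toHom (Formal.glueRight_of D _)

/-- The dot on the uppermost sheet of two glued turnbacks. -/
def topDotMove₂ (a b : ℤ) (h : b = a + 2) : Move (turnback₂ a) (turnback₂ b) where
  pre := []
  post := [.cup 0, .cap 0, .cup 0, .cap 0]
  loc := .dot 0
  source_eq := rfl
  target_eq := rfl
  dot_mem := by rintro j ⟨⟩; exact ⟨2, rfl, by norm_num⟩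
  deg_eq := by
    subst h; simp [LocalMove.degree, LocalMove.euler, LocalMove.dots, turnback₂]

/-- The dot on the lowermost sheet of two glued turnbacks. -/
def bottomDotMove₂ (a b : ℤ) (h : b = a + 2) : Move (turnback₂ a) (turnback₂ b) where
  pre := [.cup 0, .cap 0, .cup 0, .cap 0]
  post := []
  loc := .dot 0
  source_eq := rfl
  target_eq := rfl
  dot_mem := by rintro j ⟨⟩; exact ⟨2, rfl, by norm_num⟩
  deg_eq := by
    subst h; simp [LocalMove.degree, LocalMove.euler, LocalMove.dots, turnback₂]

/-- Points on the same level of two glued turnbacks lie on the same component of any cobordism. -/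
theorem turnback₂_first {a : ℤ} {Y : Diagram 2} (p : Movie (turnback₂ a) Y)
    (x x' : (turnback₂ a).Vertex) (h : x.1.1 = x'.1.1) :
    Movie.toComponent p (Movie.first p x) = Movie.toComponent p (Movie.first p x') := by
  have key : ∀ x x' : (turnback₂ a).Vertex, x.1.1 = x'.1.1 → x.1.2 = 0 → x'.1.2 = 1 →
      Movie.toComponent p (Movie.first p x) = Movie.toComponent p (Movie.first p x') := by
    rintro ⟨⟨t, j⟩, hx⟩ ⟨⟨t', j'⟩, hx'⟩ h h0 h1
    dsimp only at h h0 h1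
    subst h h0 h1
    apply Movie.toComponent_first_eq
    rcases turnback₂_vertex ⟨_, hx⟩ with e | e | e | e | e | e <;>
      obtain ⟨rfl, e⟩ := Prod.mk.inj e
    · exact ⟨0, .cup 0, (0, 0), (0, 1), rfl, .cup_turn 0, rfl, rfl⟩
    · simp at e
    · exact ⟨1, .cap 0, (1, 0), (1, 1), rfl, .cap_turn 0, rfl, rfl⟩
    · simp at e
    · exact ⟨3, .cap 0, (1, 0), (1, 1), rfl, .cap_turn 0, rfl, rfl⟩
    · simp at e
  have hj : ∀ x : (turnback₂ a).Vertex, x.1.2 = 0 ∨ x.1.2 = 1 := fun x => by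
    rcases turnback₂_vertex x with e | e | e | e | e | e <;> simp [e]
  rcases hj x with hx | hx <;> rcases hj x' with hx' | hx'
  · exact congrArg _ (congrArg _ (Subtype.ext (Prod.ext h (hx.trans hx'.symm))))
  · exact key x x' h hx hx'
  · exact (key x' x h.symm hx' hx).symm
  · exact congrArg _ (congrArg _ (Subtype.ext (Prod.ext h (hx.trans hx'.symm))))

/-- Labels that match the two arcs of the turnback with the outer arcs of two glued turnbacks, when the
latter are labelled by their level. -/
def outerLevel (x : ℕ × ℕ) : ℕ := if x.1 = 0 then 0 else 4

theorem lab_nil₂ (a : ℤ) : Movie.IsLabelling (Movie.nil : Movie (turnback₂ a) (turnback₂ a))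
    Prod.fst Prod.fst (fun x : (turnback₂ a).Vertex => x.1.1) :=
  Movie.IsLabelling.nil _ (turnback₂_label a _ rfl rfl rfl)

theorem lab_death₂ {a b : ℤ} {X : Diagram 2} {p : Movie X (turnback₂ a)} {l : ℕ × ℕ → ℕ}
    {f : Movie.Node p → ℕ} (h : Movie.IsLabelling p l Prod.fst f) (hab : a = b + 1) :
    Movie.IsLabelling (p.snoc (circleDeathMove a b hab)) l outerLevel
      (Sum.elim f fun z => outerLevel z.1) := by
  apply h.snoc
  · exact turnback_label b _ rfl rfl
  · intro y z h
    rcases turnback₂_vertex y with hy | hy | hy | hy | hy | hy <;>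
      rcases turnback_vertex z with hz | hz | hz | hz <;>
      simp [Move.Tracks, circleDeathMove, hy, hz, LocalMove.source, LocalMove.target, outerLevel] at h ⊢
  · intro z
    rcases turnback_vertex z with hz | hz | hz | hz
    · exact ⟨w00 a, Or.inl ⟨Nat.zero_le 1, hz⟩⟩
    · exact ⟨w01 a, Or.inl ⟨Nat.zero_le 1, hz⟩⟩
    · exact ⟨w40 a, Or.inr ⟨by simp [w40, circleDeathMove, LocalMove.source],
        by rw [hz]; rfl, by rw [hz]; rfl⟩⟩
    · exact ⟨w41 a, Or.inr ⟨by simp [w41, circleDeathMove, LocalMove.source],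
        by rw [hz]; rfl, by rw [hz]; rfl⟩⟩

/-- A dot carries every labelling along unchanged. -/
theorem Movie.IsLabelling.snoc_dot {n : ℕ} {K : Type} {X Y Z : Diagram n} {p : Movie X Y}
    {l l' : ℕ × ℕ → K} {f : Movie.Node p → K} (h : Movie.IsLabelling p l l' f) (m : Move Y Z) {i : ℕ}
    (hm : m.loc = .dot i)
    (hj : ∀ x y : Z.Vertex, Z.Joined x y → l' x.1 = l' y.1) :
    Movie.IsLabelling (p.snoc m) l l' (Sum.elim f fun z => l' z.1) := by
  have hw : Y.word = Z.word := by rw [m.source_eq, m.target_eq, hm]; rfl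
  apply h.snoc _ _ hj
  · rintro y z (⟨_, hyz⟩ | ⟨_, h2, h1⟩)
    · rw [hyz]
    · rw [hm] at h1
      exact congrArg l' (Prod.ext h1.symm h2.symm)
  · intro z
    refine ⟨⟨z.1, by rw [hw]; exact z.2⟩, ?_⟩
    rcases le_total z.1.1 m.pre.length with hz | hz
    · exact Or.inl ⟨hz, rfl⟩
    · exact Or.inr ⟨by rw [hm]; exact hz, rfl, by rw [hm]; rfl⟩

theorem site_topDot₂ (a b : ℤ) (h : b = a + 2) (s) :
    (topDotMove₂ a b h).IsSite s ↔ s = Sum.inl (w00 a) :=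
  ⟨fun ⟨_, hs, hx⟩ => hs.trans (congrArg Sum.inl (Subtype.ext hx)), fun hs => ⟨_, hs, rfl⟩⟩

theorem site_bottomDot₂ (a b : ℤ) (h : b = a + 2) (s) :
    (bottomDotMove₂ a b h).IsSite s ↔ s = Sum.inl (w40 a) :=
  ⟨fun ⟨_, hs, hx⟩ => hs.trans (congrArg Sum.inl (Subtype.ext hx)), fun hs => ⟨_, hs, rfl⟩⟩

theorem topDot₂_death (a b c d : ℤ) (h : b = a + 2) (h' : b = c + 1) (k : a = d + 1) (k' : c = d + 2) :
    ofMove (topDotMove₂ a b h) ≫ ofMove (circleDeathMove b c h') =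
      ofMove (circleDeathMove a d k) ≫ ofMove (topDotMove d c k') := by
  rw [ofMove_comp_ofMove, ofMove_comp_ofMove]
  apply toHom_eq_of_sameSurface
  have l1 := (lab_nil₂ a).snoc_dot (topDotMove₂ a b h) rfl (turnback₂_label b _ rfl rfl rfl)
  have l2 := lab_death₂ (lab_nil₂ a) k
  refine (lab_death₂ l1 h').sameSurface
    (l2.snoc_dot (topDotMove d c k') rfl (turnback_label c _ rfl rfl))
    (turnback₂_first _) (turnback₂_first _) ?_ ?_
  all_goals
    intro k
    rw [l1.weight_snoc _ _ _ _ _ (site_circleDeath _ _ _),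
      l2.weight_snoc _ _ _ _ _ (site_topDot _ _ _),
      (lab_nil₂ a).weight_snoc _ _ _ _ _ (site_circleDeath _ _ _),
      (lab_nil₂ a).weight_snoc _ _ _ _ _ (site_topDot₂ _ _ _)]
    simp only [topDotMove₂, topDotMove, circleDeathMove, LocalMove.euler, LocalMove.dots, ite_self,
      Nat.cast_zero]
    simp [outerLevel, v00, w00, w20, Movie.weight] <;> rfl

theorem bottomDot₂_death (a b c d : ℤ) (h : b = a + 2) (h' : b = c + 1) (k : a = d + 1)
    (k' : c = d + 2) :
    ofMove (bottomDotMove₂ a b h) ≫ ofMove (circleDeathMove b c h') =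
      ofMove (circleDeathMove a d k) ≫ ofMove (bottomDotMove d c k') := by
  rw [ofMove_comp_ofMove, ofMove_comp_ofMove]
  apply toHom_eq_of_sameSurface
  have l1 := (lab_nil₂ a).snoc_dot (bottomDotMove₂ a b h) rfl (turnback₂_label b _ rfl rfl rfl)
  have l2 := lab_death₂ (lab_nil₂ a) k
  refine (lab_death₂ l1 h').sameSurface
    (l2.snoc_dot (bottomDotMove d c k') rfl (turnback_label c _ rfl rfl))
    (turnback₂_first _) (turnback₂_first _) ?_ ?_
  all_goals
    intro k
    rw [l1.weight_snoc _ _ _ _ _ (site_circleDeath _ _ _),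
      l2.weight_snoc _ _ _ _ _ (site_bottomDot _ _ _),
      (lab_nil₂ a).weight_snoc _ _ _ _ _ (site_circleDeath _ _ _),
      (lab_nil₂ a).weight_snoc _ _ _ _ _ (site_bottomDot₂ _ _ _)]
    simp only [bottomDotMove₂, bottomDotMove, circleDeathMove, LocalMove.euler, LocalMove.dots, ite_self,
      Nat.cast_zero]
    simp [outerLevel, v20, w40, w20, Movie.weight] <;> rfl

/-- This is the commutation of the two dots on a turnback, with a turnback glued below. -/
theorem topDot₂_circleDot (a b c : ℤ) (h : b = a + 2) (h' : c = b + 2) :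
    ofMove (topDotMove₂ a b h) ≫ ofMove (circleDotMove b c h') =
      ofMove (circleDotMove a b h) ≫ ofMove (topDotMove₂ b c h') := by
  have e := congrArg (whiskerRight (turnback 0)) (top_bottom a b c h h')
  simp only [whiskerRight_comp, whiskerRight_ofMove] at e
  -- Gluing changes the degree `a` to `a + 0` or `0 + a`, which is not definitionally `a`.
  have key : ∀ a' b' c' (k : b' = a' + 2) (k' : c' = b' + 2), a' = a + 0 → b' = b + 0 → c' = c + 0 →
      ofMove (topDotMove₂ a' b' k) ≫ ofMove (circleDotMove b' c' k') =
        ofMove (circleDotMove a' b' k) ≫ ofMove (topDotMove₂ b' c' k') := by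
    rintro _ _ _ _ _ rfl rfl rfl
    exact e
  exact key a b c h h' (add_zero a).symm (add_zero b).symm (add_zero c).symm

/-- This is the commutation of the two dots on a turnback, with a turnback glued on top. -/
theorem bottomDot₂_circleDot (a b c : ℤ) (h : b = a + 2) (h' : c = b + 2) :
    ofMove (bottomDotMove₂ a b h) ≫ ofMove (circleDotMove b c h') =
      ofMove (circleDotMove a b h) ≫ ofMove (bottomDotMove₂ b c h') := by
  have e := congrArg (whiskerLeft (turnback 0)) (top_bottom a b c h h')
  simp only [whiskerLeft_comp, whiskerLeft_ofMove] at e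
  -- Gluing changes the degree `a` to `a + 0` or `0 + a`, which is not definitionally `a`.
  have key : ∀ a' b' c' (k : b' = a' + 2) (k' : c' = b' + 2), a' = 0 + a → b' = 0 + b → c' = 0 + c →
      ofMove (bottomDotMove₂ a' b' k) ≫ ofMove (circleDotMove b' c' k') =
        ofMove (circleDotMove a' b' k) ≫ ofMove (bottomDotMove₂ b' c' k') := by
    rintro _ _ _ _ _ rfl rfl rfl
    exact e.symm
  exact key a b c h h' (zero_add a).symm (zero_add b).symm (zero_add c).symm

/-! ### Neck cutting at the circle -/

theorem circleBirth_death (a b c : ℤ) (h : a = b + 1) (h' : b = c + 1) :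
    ofMove (circleBirthMove a b h) ≫ ofMove (circleDeathMove b c h') = 0 := by
  rw [ofMove_comp_ofMove]
  exact (QuotientAddGroup.eq_zero_iff _).mpr
    (Null.sphere (circleBirthMove a b h) (circleDeathMove b c h') [.cup 0] 0 ⟨rfl, rfl⟩ ⟨rfl, rfl⟩)

theorem circleBirth_dot_death (a b c : ℤ) (h : a = b + 1) (h' : c = b + 2) (h'' : c = a + 1) :
    ofMove (circleBirthMove a b h) ≫ ofMove (circleDotMove b c h') ≫
      ofMove (circleDeathMove c a h'') = 𝟙 _ := by
  have := toHom_eq_iff.mpr (Null.sphere_dot (circleBirthMove a b h) (circleDotMove b c h')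
    (circleDeathMove c a h'') [.cup 0] 0 ⟨rfl, rfl⟩ ⟨rfl, rfl⟩ ⟨rfl, rfl⟩)
  refine Eq.trans ?_ this
  rw [ofMove_comp_ofMove, ofMove_comp_toHom]
  rfl

/-- By neck cutting, a cobordism that ends in two glued turnbacks is determined by what it becomes after
its circle is capped off with a disc and with a dotted disc. -/
theorem hom_ext_turnback₂ {X : Cob 2} {a : ℤ} {f g : X ⟶ turnback₂ a} (c d e : ℤ) (h1 : c = a + 2)
    (h2 : c = d + 1) (h4 : a = e + 1)
    (h : f ≫ ofMove (circleDeathMove a e h4) = g ≫ ofMove (circleDeathMove a e h4))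
    (h' : f ≫ ofMove (circleDotMove a c h1) ≫ ofMove (circleDeathMove c d h2) =
      g ≫ ofMove (circleDotMove a c h1) ≫ ofMove (circleDeathMove c d h2)) : f = g := by
  rw [← Category.comp_id f, ← Category.comp_id g,
    neck_circle a c d e (e - 1) h1 h2 (by omega) h4 (by omega) (by omega)]
  simp only [Preadditive.comp_add, reassoc_of% h, reassoc_of% h']

theorem circleBirth_topDot₂ (a b c d : ℤ) (h : a = b + 1) (h' : c = b + 2) (k : d = a + 2)
    (k' : d = c + 1) :
    ofMove (circleBirthMove a b h) ≫ ofMove (topDotMove₂ b c h') =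
      ofMove (topDotMove a d k) ≫ ofMove (circleBirthMove d c k') := by
  apply hom_ext_turnback₂ (c + 2) d a rfl (by omega) (by omega)
  · rw [Category.assoc, Category.assoc,
      topDot₂_death b c a (b - 1) h' (by omega) (by omega) (by omega),
      reassoc_of% (circleBirth_death a b (b - 1) h (by ring)), Limits.zero_comp,
      circleBirth_death d c a k' (by omega), Limits.comp_zero]
  · rw [Category.assoc, Category.assoc,
      reassoc_of% (topDot₂_circleDot b c (c + 2) h' rfl),
      topDot₂_death c (c + 2) d a rfl (by omega) (by omega) k,
      reassoc_of% (circleBirth_dot_death a b c h h' (by omega)),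
      circleBirth_dot_death d c (c + 2) k' rfl (by omega), Category.comp_id]

theorem circleBirth_bottomDot₂ (a b c d : ℤ) (h : a = b + 1) (h' : c = b + 2) (k : d = a + 2)
    (k' : d = c + 1) :
    ofMove (circleBirthMove a b h) ≫ ofMove (bottomDotMove₂ b c h') =
      ofMove (bottomDotMove a d k) ≫ ofMove (circleBirthMove d c k') := by
  apply hom_ext_turnback₂ (c + 2) d a rfl (by omega) (by omega)
  · rw [Category.assoc, Category.assoc,
      bottomDot₂_death b c a (b - 1) h' (by omega) (by omega) (by omega),
      reassoc_of% (circleBirth_death a b (b - 1) h (by ring)), Limits.zero_comp,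
      circleBirth_death d c a k' (by omega), Limits.comp_zero]
  · rw [Category.assoc, Category.assoc,
      reassoc_of% (bottomDot₂_circleDot b c (c + 2) h' rfl),
      bottomDot₂_death c (c + 2) d a rfl (by omega) (by omega) k,
      reassoc_of% (circleBirth_dot_death a b c h h' (by omega)),
      circleBirth_dot_death d c (c + 2) k' rfl (by omega), Category.comp_id]

/-- Neck cutting for the saddle that splits a circle off the upper arc. -/
theorem splitTop_eq (a b c d : ℤ) (h : b = a + 1) (k : c = a + 2) (k' : c = b + 1) (l : a = d + 1)
    (l' : b = d + 2) :
    ofMove (splitTopMove a b h) =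
      ofMove (topDotMove a c k) ≫ ofMove (circleBirthMove c b k') +
      ofMove (circleBirthMove a d l) ≫ ofMove (circleDotMove d b l') := by
  apply hom_ext_turnback₂ (b + 2) c a rfl (by omega) h
  · rw [splitTop_death, Preadditive.add_comp, Category.assoc, Category.assoc,
      circleBirth_dot_death, circleBirth_death, Limits.comp_zero, zero_add]
  · rw [Preadditive.add_comp, Category.assoc, Category.assoc, circleBirth_dot_death,
      circle_dot_dot, reassoc_of% (splitTop_circleDot a b (b + 2) c h rfl k (by omega)),
      splitTop_death, add_zero]

/-- Neck cutting for the saddle that splits a circle off the lower arc. -/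
theorem splitBottom_eq (a b c d : ℤ) (h : b = a + 1) (k : c = a + 2) (k' : c = b + 1) (l : a = d + 1)
    (l' : b = d + 2) :
    ofMove (splitBottomMove a b h) =
      ofMove (bottomDotMove a c k) ≫ ofMove (circleBirthMove c b k') +
      ofMove (circleBirthMove a d l) ≫ ofMove (circleDotMove d b l') := by
  apply hom_ext_turnback₂ (b + 2) c a rfl (by omega) h
  · rw [splitBottom_death, Preadditive.add_comp, Category.assoc, Category.assoc,
      circleBirth_dot_death, circleBirth_death, Limits.comp_zero, zero_add]
  · rw [Preadditive.add_comp, Category.assoc, Category.assoc, circleBirth_dot_death,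
      circle_dot_dot, reassoc_of% (splitBottom_circleDot a b (b + 2) c h rfl k (by omega)),
      splitBottom_death, add_zero]

/-- The cobordism that caps off the circle between two glued turnbacks and then creates it anew. -/
def recap (a b : ℤ) (h : a = b + 2) : turnback₂ a ⟶ turnback₂ b :=
  ofMove (circleDeathMove a (b + 1) (by omega)) ≫ ofMove (circleBirthMove (b + 1) b rfl)

/-- Neck cutting at the circle, in terms of `recap`. -/
theorem circleDot_recap (a b c : ℤ) (h : b = a + 2) (h' : a = c + 2) :
    ofMove (circleDotMove a b h) ≫ recap b a h + recap a c h' ≫ ofMove (circleDotMove c a h') =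
      𝟙 _ := by
  rw [recap, recap, Category.assoc,
    ← neck_circle a b (a + 1) (c + 1) c h (by omega) rfl (by omega) rfl h']

theorem topDot₂_recap (a b c : ℤ) (h : b = a + 2) (h' : a = c + 2) :
    ofMove (topDotMove₂ a b h) ≫ recap b a h = recap a c h' ≫ ofMove (topDotMove₂ c a h') := by
  rw [recap, recap, Category.assoc, circleBirth_topDot₂ (c + 1) c a (a + 1) rfl h' (by omega) rfl,
    reassoc_of% (topDot₂_death a b (a + 1) (c + 1) h (by omega) (by omega) (by omega))]

theorem bottomDot₂_recap (a b c : ℤ) (h : b = a + 2) (h' : a = c + 2) :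
    ofMove (bottomDotMove₂ a b h) ≫ recap b a h = recap a c h' ≫ ofMove (bottomDotMove₂ c a h') := by
  rw [recap, recap, Category.assoc, circleBirth_bottomDot₂ (c + 1) c a (a + 1) rfl h' (by omega) rfl,
    reassoc_of% (bottomDot₂_death a b (a + 1) (c + 1) h (by omega) (by omega) (by omega))]

theorem death_splitTop (a b c : ℤ) (h : a = b + 1) (k : c = a + 2) :
    ofMove (circleDeathMove a b h) ≫ ofMove (splitTopMove b a h) =
      ofMove (topDotMove₂ a c k) ≫ recap c a k +
        recap a (a - 2) (by ring) ≫ ofMove (circleDotMove (a - 2) a (by ring)) := by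
  obtain rfl : b = a - 2 + 1 := by omega
  rw [splitTop_eq _ a (a + 1) (a - 2) h (by omega) rfl rfl (by ring), Preadditive.comp_add,
    recap, recap, Category.assoc,
    reassoc_of% (topDot₂_death a c (a + 1) (a - 2 + 1) k (by omega) h (by omega))]

theorem death_splitBottom (a b c : ℤ) (h : a = b + 1) (k : c = a + 2) :
    ofMove (circleDeathMove a b h) ≫ ofMove (splitBottomMove b a h) =
      ofMove (bottomDotMove₂ a c k) ≫ recap c a k +
        recap a (a - 2) (by ring) ≫ ofMove (circleDotMove (a - 2) a (by ring)) := by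
  obtain rfl : b = a - 2 + 1 := by omega
  rw [splitBottom_eq _ a (a + 1) (a - 2) h (by omega) rfl rfl (by ring), Preadditive.comp_add,
    recap, recap, Category.assoc,
    reassoc_of% (bottomDot₂_death a c (a + 1) (a - 2 + 1) k (by omega) h (by omega))]

/-! ### Matrices with one entry -/

/-- A cobordism between two glued diagrams, as a one-entry matrix between their formal sums. -/
def entry {n : ℕ} {X X' Y Y' : Cob n} (f : X.glue Y ⟶ X'.glue Y') :
    ((matBifunctor gluing).obj ((Mat_.embedding (Cob n)).obj X)).obj ((Mat_.embedding (Cob n)).obj Y) ⟶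
      ((matBifunctor gluing).obj ((Mat_.embedding (Cob n)).obj X')).obj
        ((Mat_.embedding (Cob n)).obj Y') :=
  fun _ _ => f

/-- Matrices compose entrywise through a formal sum with a single term. -/
theorem comp_apply_of_unique {C : Type} [Category.{0} C] [Preadditive C] {M N K : Mat_ C} [Unique N.ι]
    (f : M ⟶ N) (g : N ⟶ K) (a : M.ι) (b : K.ι) : (f ≫ g) a b = f a default ≫ g default b :=
  (Mat_.comp_apply f g a b).trans (Fintype.sum_unique _)

instance {n : ℕ} {X Y : Cob n} : Unique (((matBifunctor gluing).obj
    ((Mat_.embedding (Cob n)).obj X)).obj ((Mat_.embedding (Cob n)).obj Y)).ι :=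
  { default := (⟨⟩, ⟨⟩), uniq := fun _ => rfl }

instance {n : ℕ} {X : Cob n} : Unique ((Mat_.embedding (Cob n)).obj X).ι :=
  inferInstanceAs (Unique PUnit)

section

variable {n : ℕ} {X X' X'' Y Y' Y'' : Cob n}

theorem entry_comp (f : X.glue Y ⟶ X'.glue Y') (g : X'.glue Y' ⟶ X''.glue Y'') :
    entry f ≫ entry g = entry (f ≫ g) := by
  ext a b
  exact comp_apply_of_unique _ _ _ _

theorem entry_add (f g : X.glue Y ⟶ X'.glue Y') : entry f + entry g = entry (f + g) := rfl

theorem entry_id : entry (𝟙 (X.glue Y)) = 𝟙 _ := by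
  ext a b
  obtain rfl := Subsingleton.elim a b
  exact (Mat_.id_apply_self (((matBifunctor gluing).obj
    ((Mat_.embedding (Cob n)).obj X)).obj ((Mat_.embedding (Cob n)).obj Y)) a).symm

theorem matBifunctor_map_app (f : X ⟶ X') :
    ((matBifunctor gluing).map ((Mat_.embedding (Cob n)).map f)).app ((Mat_.embedding (Cob n)).obj Y) =
      entry (whiskerRight Y f) := by
  ext a b
  refine (congrArg (_ ≫ ·) ((congrArg (whiskerLeft X') (Mat_.id_apply_self _ _)).trans
    (whiskerLeft_id _ _))).trans (Category.comp_id _)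

theorem matBifunctor_obj_map (g : Y ⟶ Y') :
    ((matBifunctor gluing).obj ((Mat_.embedding (Cob n)).obj X)).map ((Mat_.embedding (Cob n)).map g) =
      entry (whiskerLeft X g) := by
  ext a b
  refine (congrArg (· ≫ _) ((congrArg (whiskerRight Y) (Mat_.id_apply_self _ _)).trans
    (whiskerRight_id _ _))).trans (Category.id_comp _)

/-- Gluing one diagram to another, as formal direct sums, gives the glued diagram `Z`. -/
noncomputable def glueIso (Z : Cob n) (e : X.glue Y = Z) :
    ((matBifunctor gluing).obj ((Mat_.embedding (Cob n)).obj X)).obj ((Mat_.embedding (Cob n)).obj Y) ≅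
      (Mat_.embedding (Cob n)).obj Z where
  hom := fun _ _ => (eqToHom e : X.glue Y ⟶ Z)
  inv := fun _ _ => (eqToHom e.symm : Z ⟶ X.glue Y)
  hom_inv_id := by
    ext a b
    refine (comp_apply_of_unique _ _ _ _).trans ((eqToHom_trans e e.symm).trans ?_)
    exact (congrFun (congrFun (entry_id (X := X) (Y := Y)) a) b)
  inv_hom_id := by
    ext a b
    refine (comp_apply_of_unique _ _ _ _).trans ((eqToHom_trans e.symm e).trans ?_)
    exact (Mat_.id_apply_self ((Mat_.embedding (Cob n)).obj Z) a).symm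

theorem entry_glueIso {Z Z' : Cob n} (e : X.glue Y = Z) (e' : X'.glue Y' = Z')
    (f : X.glue Y ⟶ X'.glue Y') (g : Z ⟶ Z') (h : f ≫ eqToHom e' = eqToHom e ≫ g) :
    entry f ≫ (glueIso Z' e').hom = (glueIso Z e).hom ≫ (Mat_.embedding (Cob n)).map g := by
  ext a b
  exact (comp_apply_of_unique _ _ _ _).trans (h.trans
    (comp_apply_of_unique (glueIso Z e).hom ((Mat_.embedding (Cob n)).map g) a b).symm)

end

theorem P₂_d (k : ℕ) : P₂.d k (k + 1) = (Mat_.embedding (Cob 2)).map (SecondProjector.d k) :=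
  CochainComplex.of_d (fun k => (Mat_.embedding (Cob 2)).obj (SecondProjector.X k))
    (fun k => (Mat_.embedding (Cob 2)).map (SecondProjector.d k)) k

/-! ### The contraction of the second projector glued to a turnback -/

section

variable {V : Type*} [Category* V] [Preadditive V] {A B E Z : V} {O C : A ⟶ B} {R : B ⟶ A}
  {R' : A ⟶ E} {O' C' : E ⟶ A} {u v : ℤ}

/-- The sign bookkeeping behind the contractions. In this and the next three statements `C + v O` or
`O + v C` is a differential, preceded by `C' + u O'`, `O' + u C'` or the saddle `S`, while `R`, `R'` and the
death `D` are, up to sign, the components of the homotopy. -/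
theorem contraction_succ (hO : O ≫ R = R' ≫ O') (hC : C ≫ R + R' ≫ C' = 𝟙 A) (hv : v = -u) :
    (C + v • O) ≫ R + R' ≫ (C' + u • O') = 𝟙 A := by
  rw [← hC, hv]
  simp only [Preadditive.add_comp, Preadditive.comp_add, Preadditive.zsmul_comp,
    Preadditive.comp_zsmul, neg_smul, Preadditive.neg_comp, hO]
  abel

theorem signed_contraction_succ (hO : O ≫ R = R' ≫ O') (hC : C ≫ R + R' ≫ C' = 𝟙 A) (hv : v = -u)
    (hu : u * u = 1) : (O + v • C) ≫ (v • R) + (u • R') ≫ (O' + u • C') = 𝟙 A := by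
  rw [← hC, hv]
  simp only [Preadditive.add_comp, Preadditive.comp_add, Preadditive.zsmul_comp,
    Preadditive.comp_zsmul, neg_smul, smul_neg, Preadditive.neg_comp,
    Preadditive.comp_neg, smul_add, hO, smul_smul, hu, one_smul]
  abel

theorem contraction_zero (D : A ⟶ Z) (S : Z ⟶ A) (hC : C ≫ R + R' ≫ C' = 𝟙 A)
    (hS : D ≫ S = O ≫ R + R' ≫ C') (hv : v = -1) : (C + v • O) ≫ R + D ≫ S = 𝟙 A := by
  rw [← hC, hv, hS]
  simp only [Preadditive.add_comp, neg_smul, one_smul, Preadditive.neg_comp]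
  abel

theorem signed_contraction_zero (D : A ⟶ Z) (S : Z ⟶ A) (hC : C ≫ R + R' ≫ C' = 𝟙 A)
    (hS : D ≫ S = O ≫ R + R' ≫ C') (hv : v = -1) : (O + v • C) ≫ (v • R) + D ≫ S = 𝟙 A := by
  rw [← hC, hv, hS]
  simp only [Preadditive.add_comp, neg_smul, one_smul, Preadditive.neg_comp, Preadditive.comp_neg]
  abel

end

namespace SecondProjector

theorem d_succ_eq (k : ℕ) : d (k + 1) = topDot k + (-1 : ℤ) ^ (k + 1) • bottomDot k := by
  rw [d_succ]
  split_ifs with h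
  · rw [h.neg_one_pow, one_smul]
  · rw [(Nat.not_even_iff_odd.mp h).neg_one_pow, neg_smul, one_smul, sub_eq_add_neg]

/-- The contraction of the second projector glued on top of a turnback: the death of the circle in the
lowest degree, and `± recap` above it. The sign makes up for that of the circle dot in the differential,
which is the lower dot of the second projector. -/
def rightContraction (b : ℤ) : ∀ k, (X (k + 1)).glue (turnback b) ⟶ (X k).glue (turnback b)
  | 0 => ofMove (circleDeathMove (2 * (0 + 1 : ℕ) - 1 + b) (0 + b) (by push_cast; ring))
  | k + 1 => (-1 : ℤ) ^ (k + 1) • recap (2 * (k + 1 + 1 : ℕ) - 1 + b) (2 * (k + 1 : ℕ) - 1 + b)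
      (by push_cast; ring)

theorem whiskerRight_d_zero (b : ℤ) : whiskerRight (turnback b) (d 0) =
    ofMove (splitTopMove (0 + b) (2 * (0 + 1 : ℕ) - 1 + b) (by push_cast; ring)) :=
  whiskerRight_ofMove _ _

theorem whiskerRight_d_succ (b : ℤ) (k : ℕ) : whiskerRight (turnback b) (d (k + 1)) =
    ofMove (topDotMove₂ (2 * (k + 1 : ℕ) - 1 + b) (2 * (k + 1 + 1 : ℕ) - 1 + b) (by push_cast; ring)) +
      (-1 : ℤ) ^ (k + 1) • ofMove (circleDotMove (2 * (k + 1 : ℕ) - 1 + b) (2 * (k + 1 + 1 : ℕ) - 1 + b)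
        (by push_cast; ring)) := by
  rw [d_succ_eq, map_add, map_zsmul]
  exact congrArg₂ (· + ·) (whiskerRight_ofMove _ _) (congrArg _ (whiskerRight_ofMove _ _))

theorem d_zero_rightContraction (b : ℤ) :
    whiskerRight (turnback b) (d 0) ≫ rightContraction b 0 = 𝟙 _ := by
  rw [whiskerRight_d_zero]
  exact splitTop_death _ _ _

theorem d_succ_rightContraction (b : ℤ) (k : ℕ) :
    whiskerRight (turnback b) (d (k + 1)) ≫ rightContraction b (k + 1) +
      rightContraction b k ≫ whiskerRight (turnback b) (d k) = 𝟙 _ := by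
  rw [whiskerRight_d_succ]
  cases k with
  | zero =>
    rw [whiskerRight_d_zero]
    exact signed_contraction_zero _ _ (circleDot_recap _ _ (2 * (0 + 1 : ℕ) - 1 + b - 2) _ (by ring))
      (death_splitTop _ _ _ _ _) (pow_one _)
  | succ k =>
    rw [whiskerRight_d_succ]
    exact signed_contraction_succ (topDot₂_recap _ _ _ _ _) (circleDot_recap _ _ _ _ _)
      ((pow_succ _ _).trans (mul_neg_one _)) (by rw [← mul_pow]; simp)

/-- The contraction of the second projector glued below a turnback. No signs are needed, since here the
circle dot is the upper dot of the second projector, whose sign in the differential is `+`. -/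
def leftContraction (b : ℤ) : ∀ k, (turnback b).glue (X (k + 1)) ⟶ (turnback b).glue (X k)
  | 0 => ofMove (circleDeathMove (b + (2 * (0 + 1 : ℕ) - 1)) (b + 0) (by push_cast; ring))
  | k + 1 => recap (b + (2 * (k + 1 + 1 : ℕ) - 1)) (b + (2 * (k + 1 : ℕ) - 1)) (by push_cast; ring)

theorem whiskerLeft_d_zero (b : ℤ) : whiskerLeft (turnback b) (d 0) =
    ofMove (splitBottomMove (b + 0) (b + (2 * (0 + 1 : ℕ) - 1)) (by push_cast; ring)) :=
  whiskerLeft_ofMove _ _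

theorem whiskerLeft_d_succ (b : ℤ) (k : ℕ) : whiskerLeft (turnback b) (d (k + 1)) =
    ofMove (circleDotMove (b + (2 * (k + 1 : ℕ) - 1)) (b + (2 * (k + 1 + 1 : ℕ) - 1))
      (by push_cast; ring)) +
    (-1 : ℤ) ^ (k + 1) • ofMove (bottomDotMove₂ (b + (2 * (k + 1 : ℕ) - 1))
      (b + (2 * (k + 1 + 1 : ℕ) - 1)) (by push_cast; ring)) := by
  rw [d_succ_eq, map_add, map_zsmul]
  exact congrArg₂ (· + ·) (whiskerLeft_ofMove _ _) (congrArg _ (whiskerLeft_ofMove _ _))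

theorem d_zero_leftContraction (b : ℤ) :
    whiskerLeft (turnback b) (d 0) ≫ leftContraction b 0 = 𝟙 _ := by
  rw [whiskerLeft_d_zero]
  exact splitBottom_death _ _ _

theorem d_succ_leftContraction (b : ℤ) (k : ℕ) :
    whiskerLeft (turnback b) (d (k + 1)) ≫ leftContraction b (k + 1) +
      leftContraction b k ≫ whiskerLeft (turnback b) (d k) = 𝟙 _ := by
  rw [whiskerLeft_d_succ]
  cases k with
  | zero =>
    rw [whiskerLeft_d_zero]
    exact contraction_zero _ _ (circleDot_recap _ _ (b + (2 * (0 + 1 : ℕ) - 1) - 2) _ (by ring))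
      (death_splitBottom _ _ _ _ _) (pow_one _)
  | succ k =>
    rw [whiskerLeft_d_succ]
    exact contraction_succ (bottomDot₂_recap _ _ _ _ _) (circleDot_recap _ _ _ _ _)
      ((pow_succ _ _).trans (mul_neg_one _))

end SecondProjector

/-! ### Tensor products with the second projector -/

/-- A move does not depend, up to identification of its ends, on the names of the ends. -/
theorem Diagram.ofMove_comp_eqToHom {n : ℕ} {X X' Y Y' : Cob n} (m : Move X Y) (m' : Move X' Y')
    (hX : X = X') (hY : Y = Y') (hpre : m.pre = m'.pre) (hpost : m.post = m'.post)
    (hloc : m.loc = m'.loc) : ofMove m ≫ eqToHom hY = eqToHom hX ≫ ofMove m' := by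
  subst hX hY
  obtain rfl : m = m' := by
    cases m; cases m'
    simp only at hpre hpost hloc
    subst hpre hpost hloc
    rfl
  simp

theorem glue_identityDiagram (X : Cob 2) : X.glue (identityDiagram 0) = X := by
  cases X
  simp [glue, identityDiagram]

/-- Gluing the identity diagram below is isomorphic to the identity functor. -/
theorem whiskerRight_identityDiagram {X Y : Cob 2} (f : X ⟶ Y) :
    whiskerRight (identityDiagram 0) f ≫ eqToHom (glue_identityDiagram Y) =
      eqToHom (glue_identityDiagram X) ≫ f := by
  induction f using hom_induction with
  | zero => simp
  | id => simp [whiskerRight_id]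
  | add f g hf hg => simp only [map_add, Preadditive.add_comp, Preadditive.comp_add, hf, hg]
  | neg f hf => simp only [map_neg, Preadditive.neg_comp, Preadditive.comp_neg, hf]
  | @comp Y Z f m hf =>
    have hm := ofMove_comp_eqToHom (m.glueRight (identityDiagram 0)) m (glue_identityDiagram Y)
      (glue_identityDiagram Z) rfl (List.append_nil _) rfl
    rw [whiskerRight_comp, whiskerRight_ofMove, Category.assoc, hm, reassoc_of% hf]

namespace SecondProjector

/-- `rightContraction` for the terms of the complex `P₂`. -/
noncomputable def columnContraction (b : ℤ) (k : ℕ) :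
    ((matBifunctor gluing).obj (P₂.X (k + 1))).obj ((Mat_.embedding (Cob 2)).obj (turnback b)) ⟶
      ((matBifunctor gluing).obj (P₂.X k)).obj ((Mat_.embedding (Cob 2)).obj (turnback b)) :=
  entry (rightContraction b k)

/-- `leftContraction` for the terms of the complex `P₂`. -/
noncomputable def rowContraction (b : ℤ) (k : ℕ) :
    ((matBifunctor gluing).obj ((Mat_.embedding (Cob 2)).obj (turnback b))).obj (P₂.X (k + 1)) ⟶
      ((matBifunctor gluing).obj ((Mat_.embedding (Cob 2)).obj (turnback b))).obj (P₂.X k) :=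
  entry (leftContraction b k)

theorem d_zero_columnContraction (b : ℤ) :
    ((matBifunctor gluing).map (P₂.d 0 1)).app ((Mat_.embedding (Cob 2)).obj (turnback b)) ≫
      columnContraction b 0 = 𝟙 _ := by
  rw [P₂_d]
  refine (congrArg (· ≫ _) (matBifunctor_map_app _)).trans ((entry_comp _ _).trans ?_)
  rw [d_zero_rightContraction]
  exact entry_id

theorem d_succ_columnContraction (b : ℤ) (k : ℕ) :
    ((matBifunctor gluing).map (P₂.d (k + 1) (k + 1 + 1))).app
        ((Mat_.embedding (Cob 2)).obj (turnback b)) ≫ columnContraction b (k + 1) +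
      columnContraction b k ≫ ((matBifunctor gluing).map (P₂.d k (k + 1))).app
        ((Mat_.embedding (Cob 2)).obj (turnback b)) = 𝟙 _ := by
  have key : entry (whiskerRight (turnback b) (d (k + 1))) ≫ entry (rightContraction b (k + 1)) +
      entry (rightContraction b k) ≫ entry (whiskerRight (turnback b) (d k)) = 𝟙 _ := by
    rw [entry_comp, entry_comp, entry_add, d_succ_rightContraction, entry_id]
  rw [← matBifunctor_map_app, ← matBifunctor_map_app] at key
  rw [P₂_d, P₂_d]
  exact key

theorem d_zero_rowContraction (b : ℤ) :
    ((matBifunctor gluing).obj ((Mat_.embedding (Cob 2)).obj (turnback b))).map (P₂.d 0 1) ≫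
      rowContraction b 0 = 𝟙 _ := by
  rw [P₂_d]
  refine (congrArg (· ≫ _) (matBifunctor_obj_map _)).trans ((entry_comp _ _).trans ?_)
  rw [d_zero_leftContraction]
  exact entry_id

theorem d_succ_rowContraction (b : ℤ) (k : ℕ) :
    ((matBifunctor gluing).obj ((Mat_.embedding (Cob 2)).obj (turnback b))).map
        (P₂.d (k + 1) (k + 1 + 1)) ≫ rowContraction b (k + 1) +
      rowContraction b k ≫ ((matBifunctor gluing).obj
        ((Mat_.embedding (Cob 2)).obj (turnback b))).map (P₂.d k (k + 1)) = 𝟙 _ := by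
  have key : entry (whiskerLeft (turnback b) (d (k + 1))) ≫ entry (leftContraction b (k + 1)) +
      entry (leftContraction b k) ≫ entry (whiskerLeft (turnback b) (d k)) = 𝟙 _ := by
    rw [entry_comp, entry_comp, entry_add, d_succ_leftContraction, entry_id]
  rw [← matBifunctor_obj_map, ← matBifunctor_obj_map] at key
  rw [P₂_d, P₂_d]
  exact key

end SecondProjector

theorem e₁_isZero (j : ℕ) : Limits.IsZero (e₁.X (j + 1)) :=
  HomologicalComplex.isZero_single_obj_X _ _ _ _ (Nat.succ_ne_zero j)

open SecondProjector HomologicalComplex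

theorem nonempty_homotopy_P₂_tensor_e₁ : Nonempty (Homotopy (𝟙 (Kom.tensor P₂ e₁)) 0) := by
  have hz : ∀ i j, Limits.IsZero (((matBifunctor (gluing (n := 2))).obj (P₂.X i)).obj (e₁.X (j + 1))) :=
    fun i j => ((matBifunctor gluing).obj (P₂.X i)).map_isZero (e₁_isZero j)
  exact nonempty_homotopy_mapBifunctor_id_zero (K := P₂) (L := e₁) (F := matBifunctor gluing)
    (fun i j => match j with
      | 0 => columnContraction 0 i
      | _ + 1 => 0)
    (fun j => match j with
      | 0 => d_zero_columnContraction 0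
      | j + 1 => (hz 0 j).eq_of_src _ _)
    (fun i j => match j with
      | 0 => d_succ_columnContraction 0 i
      | j + 1 => (hz (i + 1) j).eq_of_src _ _)

/-- The rows of this double complex are columns of the one with its indices exchanged. -/
theorem nonempty_homotopyEquiv_e₁_tensor_P₂ : Nonempty (HomotopyEquiv (Kom.tensor e₁ P₂) 0) := by
  have hz : ∀ i j, Limits.IsZero (((matBifunctor (gluing (n := 2))).flip.obj (P₂.X i)).obj (e₁.X (j + 1))) :=
    fun i j => ((matBifunctor gluing).flip.obj (P₂.X i)).map_isZero (e₁_isZero j)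
  obtain ⟨H⟩ := nonempty_homotopy_mapBifunctor_id_zero (K := P₂) (L := e₁) (F := (matBifunctor gluing).flip)
    (fun i j => match j with
      | 0 => rowContraction 0 i
      | _ + 1 => 0)
    (fun j => match j with
      | 0 => d_zero_rowContraction 0
      | j + 1 => (hz 0 j).eq_of_src _ _)
    (fun i j => match j with
      | 0 => d_succ_rowContraction 0 i
      | j + 1 => (hz (i + 1) j).eq_of_src _ _)
  exact ⟨(HomotopyEquiv.ofIso (mapBifunctorFlipIso e₁ P₂ (matBifunctor gluing) (ComplexShape.up ℕ)).symm).trans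
    H.equivZero⟩

theorem nonempty_homotopyEquiv_P₂_tensor_P₂ : Nonempty (HomotopyEquiv (Kom.tensor P₂ P₂) P₂) :=
  nonempty_homotopyEquiv_firstColumn (K := P₂) (L := P₂) (F := matBifunctor gluing)
    (fun k => glueIso (X k) (glue_identityDiagram (X k)))
    (fun k => by
      rw [P₂_d]
      exact (congrArg (· ≫ _) (matBifunctor_map_app _)).trans
        (entry_glueIso _ _ _ _ (whiskerRight_identityDiagram _)))
    (fun i j => columnContraction (2 * (j + 1 : ℕ) - 1) i)
    (fun _ => d_zero_columnContraction _)
    (fun i _ => d_succ_columnContraction _ i)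

end BarNatan

theorem theorem4p2 :
    Nonempty (HomotopyEquiv (BarNatan.Kom.tensor BarNatan.P₂ BarNatan.e₁) 0) ∧
    Nonempty (HomotopyEquiv 0 (BarNatan.Kom.tensor BarNatan.e₁ BarNatan.P₂)) ∧
    Nonempty (HomotopyEquiv (BarNatan.Kom.tensor BarNatan.P₂ BarNatan.P₂) BarNatan.P₂) :=
  ⟨BarNatan.nonempty_homotopy_P₂_tensor_e₁.map Homotopy.equivZero,
    BarNatan.nonempty_homotopyEquiv_e₁_tensor_P₂.map HomotopyEquiv.symm,
    BarNatan.nonempty_homotopyEquiv_P₂_tensor_P₂⟩
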